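/- Let $G=SU(2)$, let $\mathfrak g=\mathfrak{sl}_2(\mathbb C)$ be its complexified Lie algebra, and let $V=\mathfrak{sl}_2(\mathbb C)$ be the (complexified) adjoint representation, on which $G$ acts by $\mathrm{Ad}(g)A=gAg^{-1}$ and $\mathfrak g$ by $\mathrm{ad}(\xi)A=[\xi,A]$. For $n\ge 1$ let $V^{\oplus n}$ carry the diagonal actions, and let $x_1,\dots,x_{3n}$ be the linear coordinates on $V^{\oplus n}$ given by the standard basis $h,x,y$ of $\mathfrak{sl}_2(\mathbb C)$ in each summand. Let $\mathcal O(V^{\oplus n})=\mathbb C[x_1,\dots,x_{3n}]$, and let $\mathcal O(V^{\oplus n})^G$ be the subalgebra of $G$-invariant polynomial functions. The coordinate ring of the arc space is $$\mathcal O(J_\infty(V^{\oplus n}))=\mathbb C[x_j^{(i)}\mid 1\le j\le 3n,\ i\ge 0],$$ with the $\mathbb C$-linear derivation $D$ given by $D(x_j^{(i)})=x_j^{(i+1)}$; it contains $\mathcal O(V^{\oplus n})$ by $x_j=x_j^{(0)}$. The Lie algebra $\mathfrak g[t]=\mathfrak g\otimes\mathbb C[t]$ acts on it by the derivations with $$\xi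 t^r\,(x_j^{(i)})=\frac{i!}{(i-r)!}\,(\xi x_j)^{(i-r)}\ \text{ for } 0\le r\le i,\qquad \xi t^r\,(x_j^{(i)})=0\ \text{ for } r>i,$$ where $\xi x_j=-x_j\circ\xi$ is the dual action of $\xi\in\mathfrak g$ on linear forms and $(\sum_l c_l x_l)^{(k)}=\sum_l c_l x_l^{(k)}$. Let $\mathcal O(J_\infty(V^{\oplus n}))^{\mathfrak g[t]}$ be the subalgebra of the elements annihilated by all of $\mathfrak g[t]$, and let $\langle \mathcal O(V^{\oplus n})^G\rangle$ be the subalgebra generated by all $D^i(f)$ with $f\in\mathcal O(V^{\oplus n})^G$ and $i\ge 0$. Then $$\mathcal O(J_\infty(V\oplus V))^{\mathfrak g[t]}=\langle\mathcal O(V\oplus V)^G\rangle\quad\text{and}\quad \mathcal O(J_\infty(V\oplus V\oplus V))^{\mathfrak g[t]}=\langle\mathcal O(V\oplus V\oplus V)^G\rangle .$$ -/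

import Mathlib

open scoped TensorProduct

noncomputable section

namespace ArcSpace

/-! ### Coordinate rings of a vector space and of its arc space -/

section General

attribute [local instance 100] LieRing.ofAssociativeRing

variable {ι V L G : Type*} [Fintype ι] [AddCommGroup V] [Module ℂ V]
  [LieRing L] [LieAlgebra ℂ L] [Group G]

/-- The coordinate ring `O(J_∞(V))` of the arc space of a vector space `V` with linear coordinates
`x_i`, `i : ι`: the polynomial ring on the symbols `x_i^{(k)}`, `k = 0, 1, 2, …`, where
`x_i^{(k)} = X (i, k)`. As a function of an arc `v(t) ∈ V[[t]]`, the variable `x_i^{(k)}` is `k!`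
times the coefficient of `t ^ k` in `x_i(v(t))`. -/
abbrev ArcRing (ι : Type*) : Type _ := MvPolynomial (ι × ℕ) ℂ

/-- The derivation `D` of `O(J_∞(V))`, given by `D (x_i^{(k)}) = x_i^{(k+1)}`. -/
def arcD (ι : Type*) : Derivation ℂ (ArcRing ι) (ArcRing ι) :=
  MvPolynomial.mkDerivation ℂ fun p => MvPolynomial.X (p.1, p.2 + 1)

/-- The inclusion `O(V) ⊆ O(J_∞(V))` which identifies `x_i` with `x_i^{(0)}`. -/
def toArc (ι : Type*) : MvPolynomial ι ℂ →ₐ[ℂ] ArcRing ι :=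
  MvPolynomial.rename fun i => (i, 0)

/-- `⟨S⟩`: the differential subalgebra of `O(J_∞(V))` generated by a subalgebra `S` of `O(V)`,
that is, the algebra generated by all `D^k f` with `f ∈ S` and `k ≥ 0`. -/
def differentialSpan (S : Subalgebra ℂ (MvPolynomial ι ℂ)) : Subalgebra ℂ (ArcRing ι) :=
  Algebra.adjoin ℂ {F | ∃ f ∈ S, ∃ k : ℕ, F = (arcD ι)^[k] (toArc ι f)}

/-- The algebra `O(V)^G` of the polynomial functions on `V` that are invariant under the group `G`
acting through `ρ`. Polynomials are evaluated at vectors by means of the basis `b`. -/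
def polyInvariants (ρ : Representation ℂ G V) (b : Module.Basis ι ℂ V) :
    Subalgebra ℂ (MvPolynomial ι ℂ) where
  carrier := {f | ∀ (g : G) (v : V),
    MvPolynomial.eval (b.repr (ρ g v)) f = MvPolynomial.eval (b.repr v) f}
  mul_mem' := by
    intro f f' hf hf' g v
    rw [map_mul, map_mul, hf g v, hf' g v]
  add_mem' := by
    intro f f' hf hf' g v
    rw [map_add, map_add, hf g v, hf' g v]
  algebraMap_mem' := by
    intro c g v
    simp [MvPolynomial.algebraMap_eq]

/-- The element `(ξ x_i)^{(k)}` of `O(J_∞(V))`, where `ξ` acts on the linear form `x_i` by the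
dual of the representation `ρ`: `ξ x_i = - x_i ∘ ρ(ξ) = - ∑ j, x_i(ρ(ξ) b_j) x_j`. -/
def dualForm (ρ : L →ₗ⁅ℂ⁆ Module.End ℂ V) (b : Module.Basis ι ℂ V) (ξ : L) (i : ι) (k : ℕ) :
    ArcRing ι :=
  -∑ j, (b.repr (ρ ξ (b j)) i) • (MvPolynomial.X (j, k) : ArcRing ι)

/-- The action of `ξ t^r` on `O(J_∞(V))`: the derivation with
`ξ t^r (x_i^{(k)}) = k! / (k-r)! (ξ x_i)^{(k-r)}` for `r ≤ k`, and
`ξ t^r (x_i^{(k)}) = 0` for `r > k`. -/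
def monomialAction (ρ : L →ₗ⁅ℂ⁆ Module.End ℂ V) (b : Module.Basis ι ℂ V) (r : ℕ) :
    L →ₗ[ℂ] Derivation ℂ (ArcRing ι) (ArcRing ι) where
  toFun ξ := MvPolynomial.mkDerivation ℂ fun p =>
    (p.2.descFactorial r : ℂ) • dualForm ρ b ξ p.1 (p.2 - r)
  map_add' ξ η := by
    apply MvPolynomial.derivation_ext
    intro p
    simp only [dualForm, MvPolynomial.mkDerivation_X, Derivation.add_apply, map_add,
      LinearMap.add_apply, Finsupp.add_apply, add_smul, Finset.sum_add_distrib, neg_add, smul_add]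
  map_smul' c ξ := by
    apply MvPolynomial.derivation_ext
    intro p
    simp only [dualForm, MvPolynomial.mkDerivation_X, Derivation.smul_apply, map_smul,
      LinearMap.smul_apply, Finsupp.smul_apply, smul_assoc, ← Finset.smul_sum, ← smul_neg,
      RingHom.id_apply]
    rw [smul_comm]

lemma monomialAction_X (ρ : L →ₗ⁅ℂ⁆ Module.End ℂ V) (b : Module.Basis ι ℂ V) (r : ℕ) (ξ : L)
    (i : ι) (k : ℕ) :
    monomialAction ρ b r ξ (MvPolynomial.X (i, k)) =
      (k.descFactorial r : ℂ) • dualForm ρ b ξ i (k - r) := by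
  simp [monomialAction]

lemma monomialAction_dualForm (ρ : L →ₗ⁅ℂ⁆ Module.End ℂ V) (b : Module.Basis ι ℂ V) (r : ℕ)
    (ξ η : L) (i : ι) (k : ℕ) :
    monomialAction ρ b r ξ (dualForm ρ b η i k) = (k.descFactorial r : ℂ) •
      ∑ j, (b.repr (ρ η (ρ ξ (b j))) i) • (MvPolynomial.X (j, k - r) : ArcRing ι) := by
  have key : ∀ l, b.repr (ρ η (ρ ξ (b l))) i =
      ∑ j, b.repr (ρ ξ (b l)) j * b.repr (ρ η (b j)) i := by
    intro l
    conv_lhs => rw [← b.sum_repr (ρ ξ (b l))]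
    simp only [map_sum, map_smul, Finsupp.coe_finsetSum, Finset.sum_apply, Finsupp.smul_apply,
      smul_eq_mul]
  simp only [key]
  conv_lhs => rw [dualForm]
  simp only [map_neg, map_sum, Derivation.map_smul, monomialAction_X]
  simp only [dualForm, smul_neg, Finset.sum_neg_distrib, neg_neg, Finset.smul_sum,
    Finset.sum_smul]
  rw [Finset.sum_comm]
  refine Finset.sum_congr rfl fun l _ => Finset.sum_congr rfl fun j _ => ?_
  simp only [smul_smul]
  congr 1
  ring

lemma monomialAction_lie (ρ : L →ₗ⁅ℂ⁆ Module.End ℂ V) (b : Module.Basis ι ℂ V) (r s : ℕ)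
    (ξ η : L) :
    monomialAction ρ b (r + s) ⁅ξ, η⁆ = ⁅monomialAction ρ b r ξ, monomialAction ρ b s η⁆ := by
  have hd : ∀ k r s : ℕ, (k.descFactorial s : ℂ) * ((k - s).descFactorial r : ℂ) =
      (k.descFactorial (r + s) : ℂ) := by
    intro k r s
    have h := Nat.descFactorial_mul_descFactorial (k := s) (m := r + s) (n := k) (by omega)
    rw [Nat.add_sub_cancel] at h
    rw [← h, Nat.cast_mul, mul_comm]
  apply MvPolynomial.derivation_ext
  rintro ⟨i, k⟩
  rw [Derivation.commutator_apply]
  simp only [monomialAction_X, Derivation.map_smul, monomialAction_dualForm, smul_smul, hd]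
  rw [add_comm s r, ← smul_sub, ← Finset.sum_sub_distrib]
  rw [show k - s - r = k - (r + s) by omega, show k - r - s = k - (r + s) by omega]
  congr 1
  rw [dualForm, ← Finset.sum_neg_distrib]
  refine Finset.sum_congr rfl fun j _ => ?_
  rw [← sub_smul, ← neg_smul]
  congr 1
  simp [LieRing.of_associative_ring_bracket]

/-- The action of the Lie algebra `𝔤[t] = ℂ[t] ⊗ 𝔤` on `O(J_∞(V))` by derivations, in which
`t^r ⊗ ξ` acts as `ξ t^r`. -/
def currentAction (ρ : L →ₗ⁅ℂ⁆ Module.End ℂ V) (b : Module.Basis ι ℂ V) :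
    Polynomial ℂ ⊗[ℂ] L →ₗ⁅ℂ⁆ Derivation ℂ (ArcRing ι) (ArcRing ι) where
  __ := TensorProduct.lift
    (Polynomial.lsum fun r => LinearMap.toSpanSingleton ℂ _ (monomialAction ρ b r))
  map_lie' := by
    intro u v
    simp only [AddHom.toFun_eq_coe, LinearMap.coe_toAddHom]
    induction u with
    | zero => simp
    | add u u' hu hu' => simp only [add_lie, map_add, hu, hu']
    | tmul p ξ =>
      induction v with
      | zero => simp
      | add v v' hv hv' => simp only [lie_add, map_add, hv, hv']
      | tmul q η =>
        induction p using Polynomial.induction_on' with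
        | add p p' hp hp' => simp only [TensorProduct.add_tmul, add_lie, map_add, hp, hp']
        | monomial r c =>
          induction q using Polynomial.induction_on' with
          | add q q' hq hq' => simp only [TensorProduct.add_tmul, lie_add, map_add, hq, hq']
          | monomial s d =>
            simp [LieAlgebra.ExtendScalars.bracket_tmul, Polynomial.monomial_mul_monomial,
              monomialAction_lie, Polynomial.lsum_apply, Polynomial.sum_monomial_index, mul_smul]
            rw [smul_comm]

lemma currentAction_monomial_tmul (ρ : L →ₗ⁅ℂ⁆ Module.End ℂ V) (b : Module.Basis ι ℂ V) (r : ℕ)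
    (c : ℂ) (ξ : L) :
    currentAction ρ b (Polynomial.monomial r c ⊗ₜ ξ) = c • monomialAction ρ b r ξ := by
  change TensorProduct.lift _ (_ ⊗ₜ _) = _
  simp [Polynomial.lsum_apply, Polynomial.sum_monomial_index]

/-- The algebra `O(J_∞(V))^{𝔤[t]}`: the elements killed by all of `𝔤[t]`. -/
def arcInvariants (ρ : L →ₗ⁅ℂ⁆ Module.End ℂ V) (b : Module.Basis ι ℂ V) :
    Subalgebra ℂ (ArcRing ι) where
  carrier := {F | ∀ u : Polynomial ℂ ⊗[ℂ] L, currentAction ρ b u F = 0}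
  mul_mem' := by
    intro F F' hF hF' u
    rw [Derivation.leibniz, hF u, hF' u, smul_zero, smul_zero, add_zero]
  add_mem' := by
    intro F F' hF hF' u
    rw [map_add, hF u, hF' u, add_zero]
  algebraMap_mem' := by
    intro c u
    exact Derivation.map_algebraMap _ c

/-- The diagonal action of a group on `V ⊕ ⋯ ⊕ V` (`n` copies). -/
def groupCopies (ρ : Representation ℂ G V) (n : ℕ) : Representation ℂ G (Fin n → V) where
  toFun g := LinearMap.pi fun m => ρ g ∘ₗ LinearMap.proj m
  map_one' := by ext; simp
  map_mul' g h := by ext; simp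

/-- The diagonal action of a Lie algebra on `V ⊕ ⋯ ⊕ V` (`n` copies). -/
def lieCopies (ρ : L →ₗ⁅ℂ⁆ Module.End ℂ V) (n : ℕ) :
    L →ₗ⁅ℂ⁆ Module.End ℂ (Fin n → V) where
  toFun ξ := LinearMap.pi fun m => ρ ξ ∘ₗ LinearMap.proj m
  map_add' ξ η := by ext; simp
  map_smul' c ξ := by ext; simp
  map_lie' {ξ η} := by
    refine LinearMap.ext fun v => funext fun m => ?_
    simp [LieRing.of_associative_ring_bracket]

end General

/-! ### The adjoint representation of `SU(2)` -/

/-- The compact group `SU(2)`. -/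
abbrev SU2 : Type := Matrix.specialUnitaryGroup (Fin 2) ℂ

/-- The complexified Lie algebra `𝔰𝔩₂` of `SU(2)`: complex `2 × 2` matrices of trace zero. -/
abbrev Sl2 : Type := LieAlgebra.SpecialLinear.sl (Fin 2) ℂ

/-- The linear coordinates `(a^h, a^x, a^y)` on `𝔰𝔩₂`: the matrix `a^h h + a^x x + a^y y` is
`!![a^h, a^x; a^y, -a^h]`. -/
def sl2Coord : Sl2 ≃ₗ[ℂ] (Fin 3 → ℂ) where
  toFun A := ![A.1 0 0, A.1 0 1, A.1 1 0]
  map_add' A B := by ext i; fin_cases i <;> simp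
  map_smul' c A := by ext i; fin_cases i <;> simp
  invFun a := ⟨!![a 0, a 1; a 2, -a 0], by
    change _ ∈ LinearMap.ker (Matrix.traceLinearMap (Fin 2) ℂ ℂ)
    simp [Matrix.trace_fin_two]⟩
  left_inv A := by
    have h : A.1 0 0 + A.1 1 1 = 0 := by
      rw [← Matrix.trace_fin_two]
      exact A.2
    apply Subtype.ext
    ext i j
    fin_cases i <;> fin_cases j <;> simp
    exact neg_eq_of_add_eq_zero_right h
  right_inv a := by ext i; fin_cases i <;> simp

/-- The standard basis `(h, x, y)` of `𝔰𝔩₂`. -/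
def sl2Basis : Module.Basis (Fin 3) ℂ Sl2 := Module.Basis.ofEquivFun sl2Coord

/-- The standard basis of `V ⊕ ⋯ ⊕ V` (`n` copies of `V = 𝔰𝔩₂`). -/
def copiesBasis (n : ℕ) : Module.Basis (Σ _ : Fin n, Fin 3) ℂ (Fin n → Sl2) :=
  Pi.basis fun _ => sl2Basis

/-- The adjoint representation of the group `SU(2)` on `V = 𝔰𝔩₂`, by `Ad(g) A = g A g⁻¹`. -/
def adjointRep : Representation ℂ SU2 Sl2 where
  toFun g :=
    { toFun := fun A => ⟨g.1 * A.1 * (g⁻¹).1, by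
        change _ ∈ LinearMap.ker (Matrix.traceLinearMap (Fin 2) ℂ ℂ)
        have h : (g⁻¹).1 * g.1 = 1 := congrArg Subtype.val (inv_mul_cancel g)
        rw [LinearMap.mem_ker, Matrix.traceLinearMap_apply, Matrix.trace_mul_comm, ← mul_assoc, h,
          one_mul]
        exact A.2⟩
      map_add' := fun A B => by
        apply Subtype.ext
        simp [mul_add, add_mul]
      map_smul' := fun c A => by
        apply Subtype.ext
        simp }
  map_one' := by
    refine LinearMap.ext fun A => Subtype.ext ?_
    simp
  map_mul' g h := by
    refine LinearMap.ext fun A => Subtype.ext ?_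
    simp [mul_assoc]

/-- The algebra `O(V ⊕ ⋯ ⊕ V)^G` (`n` copies), with `G = SU(2)` and `V` its adjoint
representation. -/
def classicalInvariants (n : ℕ) : Subalgebra ℂ (MvPolynomial (Σ _ : Fin n, Fin 3) ℂ) :=
  polyInvariants (groupCopies adjointRep n) (copiesBasis n)

/-- The algebra `O(J_∞(V ⊕ ⋯ ⊕ V))^{𝔤[t]}` (`n` copies), with `𝔤 = 𝔰𝔩₂` acting on `V = 𝔰𝔩₂` by the
adjoint representation. -/
def currentInvariants (n : ℕ) : Subalgebra ℂ (ArcRing (Σ _ : Fin n, Fin 3)) :=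
  arcInvariants (lieCopies (LieAlgebra.ad ℂ Sl2) n) (copiesBasis n)

end ArcSpace

end

noncomputable section

namespace ArcSpace

open MvPolynomial

/-! ### Evaluation at arcs -/

section Arcs

variable {ι κ μ : Type*} {K K' : Type*} [CommRing K'] [Algebra ℂ K'] [CommRing K] [Algebra ℂ K]

/-! Upper bound and lower bound meet in the image of `arcMap gramMap`, the algebra generated by the
derivatives of the Gram matrix entries and of the determinant of three vectors in `𝔰𝔩₂`. This image
lies in the differential span of the classical invariants, which lies in the current invariants
(`differentialSpan_le_currentInvariants`): `SU(2)`-invariance differentiates to `𝔰𝔩₂`-invariance, `ξ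
t^r` with `r > 0` kills level zero, and `D` normalises the action of `𝔤[t]`. It remains to write
each current invariant `F` of three copies in terms of Gram data; the classical first fundamental
theorem is not needed for this.

Generically: `F` is constant along the unipotent subgroups of `SL₂(ℂ[[t]])`, and these move a
generic triple of arcs to a triple `(s h, u h + x + w y, p h + m x + n y)` (`exists_sliceArc`).
There `s²` is the first Gram entry, and after inverting `e = q₀ (4 q₀ q₁ - b₀₁²)`, where `q` is
`-det` and `b` its polar form, every coordinate is a polynomial in the constant term of `s` and the
Gram data (`saturation_gramSliceAlgebra_eq_top`). Averaging over the roots `s` and `-s` gives `e^N F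
= G` with `G` in the image (`exists_gramMinor_pow_mul_eq`). A cyclic permutation of the copies gives
`e'^M F = H` for a second minor `e'`.

Clearing denominators: the Gram data satisfy `d² = -4 det`. For suitable weights, the coefficients
of this equation at all `t^k`, together with powers of `e` and `e'`, have pairwise coprime leading
monomials and hence form a regular sequence in any order (`mem_span_of_mul_mem`). Since `e` is
regular modulo `gramIdeal`, this ideal contains all relations (`mem_gramIdeal_iff`). Since `e'` is
regular modulo a power of `e` and `gramIdeal`, comparing the two fractions for `F` shows that `G` is
divisible by the power of `e` modulo relations, so `F` lies in the image
(`exists_arcMap_gramMap_eq`).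

Two copies are handled by viewing `F` as an invariant of three copies and setting the third vector
to zero. -/

/-- The Taylor expansion of the functions on the arc space along an arc `v`. -/
def arcTaylor (v : ι → PowerSeries K) : ArcRing ι →ₐ[ℂ] PowerSeries K :=
  aeval fun p => (PowerSeries.derivative K)^[p.2] (v p.1)

/-- The evaluation of the functions on the arc space at a `K`-valued arc `v`. -/
def arcEval (v : ι → PowerSeries K) : ArcRing ι →ₐ[ℂ] K :=
  aeval fun p => (p.2.factorial : K) * PowerSeries.coeff p.2 (v p.1)

@[simp] lemma arcEval_X (v : ι → PowerSeries K) (i : ι) (k : ℕ) :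
    arcEval v (X (i, k)) = (k.factorial : K) * PowerSeries.coeff k (v i) := by
  simp [arcEval]

lemma constantCoeff_iterate_derivative {S : Type*} [CommRing S] (f : PowerSeries S) (k : ℕ) :
    PowerSeries.constantCoeff ((PowerSeries.derivative S)^[k] f) =
      (k.factorial : S) * PowerSeries.coeff k f := by
  induction k generalizing f with
  | zero => simp
  | succ k ih =>
    rw [Function.iterate_succ_apply, ih, PowerSeries.coeff_derivative, Nat.factorial_succ]
    push_cast
    ring

lemma arcEval_eq (v : ι → PowerSeries K) (F : ArcRing ι) :
    arcEval v F = PowerSeries.constantCoeff (arcTaylor v F) := by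
  induction F using MvPolynomial.induction_on with
  | C a => simp [arcEval, arcTaylor, MvPolynomial.algHom_C, PowerSeries.algebraMap_apply]
  | add p q hp hq => simp [hp, hq]
  | mul_X p n hp =>
    rw [map_mul, map_mul, map_mul, hp]
    congr 1
    rw [arcTaylor, aeval_X, constantCoeff_iterate_derivative, ← arcEval_X]

lemma derivative_algebraMap (c : ℂ) :
    PowerSeries.derivative K (algebraMap ℂ (PowerSeries K) c) = 0 := by
  rw [PowerSeries.algebraMap_apply]
  simp

lemma arcTaylor_arcD (v : ι → PowerSeries K) (F : ArcRing ι) :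
    arcTaylor v (arcD ι F) = PowerSeries.derivative K (arcTaylor v F) := by
  induction F using MvPolynomial.induction_on with
  | C a =>
    rw [MvPolynomial.algHom_C, derivative_algebraMap]
    simp [arcD]
  | add p q hp hq => simp [hp, hq]
  | mul_X p n hp =>
    rw [Derivation.leibniz, map_add, map_mul, Derivation.leibniz]
    simp only [smul_eq_mul, map_mul, hp]
    congr 2
    simp [arcTaylor, arcD, mkDerivation_X, Function.iterate_succ_apply']

lemma arcTaylor_iterate_arcD (v : ι → PowerSeries K) (F : ArcRing ι) (k : ℕ) :
    arcTaylor v ((arcD ι)^[k] F) = (PowerSeries.derivative K)^[k] (arcTaylor v F) := by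
  induction k generalizing F with
  | zero => rfl
  | succ k ih => rw [Function.iterate_succ_apply, ih, arcTaylor_arcD, Function.iterate_succ_apply]

lemma arcTaylor_toArc (v : ι → PowerSeries K) (f : MvPolynomial ι ℂ) :
    arcTaylor v (toArc ι f) = aeval v f := by
  simp only [arcTaylor, toArc, aeval_rename]
  rfl

/-- The value of `D^k f` at an arc `v` is `k!` times the coefficient of `t^k` in `f(v)`. -/
lemma arcEval_iterate_arcD (v : ι → PowerSeries K) (f : MvPolynomial ι ℂ) (k : ℕ) :
    arcEval v ((arcD ι)^[k] (toArc ι f)) =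
      (k.factorial : K) * PowerSeries.coeff k (aeval v f) := by
  rw [arcEval_eq, arcTaylor_iterate_arcD, constantCoeff_iterate_derivative, arcTaylor_toArc]

lemma arcEval_toArc (v : ι → PowerSeries K) (f : MvPolynomial ι ℂ) :
    arcEval v (toArc ι f) = PowerSeries.constantCoeff (aeval v f) := by
  simpa using arcEval_iterate_arcD v f 0

lemma aeval_map_series (φ : K →ₐ[ℂ] K') (v : ι → PowerSeries K) (f : MvPolynomial ι ℂ) :
    aeval (fun i => PowerSeries.map (φ : K →+* K') (v i)) f =
      PowerSeries.map (φ : K →+* K') (aeval v f) := by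
  induction f using MvPolynomial.induction_on with
  | C a =>
    rw [MvPolynomial.algHom_C, MvPolynomial.algHom_C]
    rw [PowerSeries.algebraMap_apply, PowerSeries.algebraMap_apply]
    simp
  | add p q hp hq => simp [hp, hq]
  | mul_X p n hp => simp [hp]

/-- The arc with independent coefficients. -/
def genericArc (ι : Type*) (i : ι) : PowerSeries (ArcRing ι) :=
  PowerSeries.mk fun k => C (k.factorial : ℂ)⁻¹ * X (i, k)

lemma C_factorial_cancel {σ : Type*} (k : ℕ) (F : MvPolynomial σ ℂ) :
    (k.factorial : MvPolynomial σ ℂ) * (C (k.factorial : ℂ)⁻¹ * F) = F := by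
  rw [← mul_assoc, ← map_natCast (C (σ := σ) (R := ℂ)), ← C_mul,
    mul_inv_cancel₀ (Nat.cast_ne_zero.2 k.factorial_ne_zero)]
  simp

/-- The generic arc is the universal point: through it, evaluation formulas over an arbitrary `K`
become identities in the arc ring itself. -/
lemma arcEval_genericArc (F : ArcRing ι) : arcEval (genericArc ι) F = F := by
  have : arcEval (genericArc ι) = AlgHom.id ℂ (ArcRing ι) := by
    apply MvPolynomial.algHom_ext
    rintro ⟨i, k⟩
    rw [arcEval_X, genericArc, PowerSeries.coeff_mk, C_factorial_cancel, AlgHom.id_apply]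
  exact DFunLike.congr_fun this F

lemma iterate_arcD_toArc (f : MvPolynomial ι ℂ) (k : ℕ) :
    (arcD ι)^[k] (toArc ι f) =
      (k.factorial : ArcRing ι) * PowerSeries.coeff k (aeval (genericArc ι) f) := by
  rw [← arcEval_iterate_arcD, arcEval_genericArc]

lemma coeff_aeval_genericArc (f : MvPolynomial ι ℂ) (k : ℕ) :
    PowerSeries.coeff k (aeval (genericArc ι) f) =
      C (k.factorial : ℂ)⁻¹ * (arcD ι)^[k] (toArc ι f) := by
  rw [iterate_arcD_toArc, mul_left_comm, C_factorial_cancel]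

/-- Every system of values of the coordinates on the arc space comes from an arc. -/
lemma arcRing_ext {F F' : ArcRing ι}
    (h : ∀ v : ι → PowerSeries ℂ, arcEval v F = arcEval v F') : F = F' := by
  apply MvPolynomial.funext
  intro x
  have key : ∀ F : ArcRing ι, eval x F =
      arcEval (fun i => PowerSeries.mk fun k => (k.factorial : ℂ)⁻¹ * x (i, k)) F := by
    intro F
    have : (aeval x : ArcRing ι →ₐ[ℂ] ℂ) =
        arcEval (fun i => PowerSeries.mk fun k => (k.factorial : ℂ)⁻¹ * x (i, k)) := by
      apply MvPolynomial.algHom_ext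
      rintro ⟨i, k⟩
      rw [arcEval_X, aeval_X, PowerSeries.coeff_mk,
        mul_inv_cancel_left₀ (Nat.cast_ne_zero.2 k.factorial_ne_zero)]
    rw [← this]
    rfl
  rw [key, key, h]

/-- Two functions on the arc space agree if they agree at the arcs where a nonzero function does
not vanish. -/
lemma arcRing_ext_of_ne_zero {F F' G : ArcRing ι} (hG : G ≠ 0)
    (h : ∀ v : ι → PowerSeries ℂ, arcEval v G ≠ 0 → arcEval v F = arcEval v F') : F = F' := by
  have : G * F = G * F' := by
    apply arcRing_ext
    intro v
    by_cases hv : arcEval v G = 0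
    · simp [hv]
    · rw [map_mul, map_mul, h v hv]
  exact mul_left_cancel₀ hG this

/-- The homomorphism of coordinate rings of arc spaces induced by a polynomial map. -/
def arcMap (Q : κ → MvPolynomial ι ℂ) : ArcRing κ →ₐ[ℂ] ArcRing ι :=
  arcEval fun j => aeval (genericArc ι) (Q j)

lemma arcMap_X (Q : κ → MvPolynomial ι ℂ) (j : κ) (k : ℕ) :
    arcMap Q (X (j, k)) = (arcD ι)^[k] (toArc ι (Q j)) := by
  rw [arcMap, arcEval_X, iterate_arcD_toArc]

lemma arcEval_arcMap (Q : κ → MvPolynomial ι ℂ) (v : ι → PowerSeries K) (F : ArcRing κ) :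
    arcEval v (arcMap Q F) = arcEval (fun j => aeval v (Q j)) F := by
  have : (arcEval v).comp (arcMap Q) = arcEval (fun j => aeval v (Q j)) := by
    apply MvPolynomial.algHom_ext
    rintro ⟨j, k⟩
    rw [AlgHom.comp_apply, arcMap_X, arcEval_iterate_arcD, arcEval_X]
  exact DFunLike.congr_fun this F

lemma arcMap_iterate_arcD (Q : κ → MvPolynomial ι ℂ) (f : MvPolynomial κ ℂ) (k : ℕ) :
    arcMap Q ((arcD κ)^[k] (toArc κ f)) = (arcD ι)^[k] (toArc ι (aeval Q f)) := by
  rw [arcMap, arcEval_iterate_arcD, iterate_arcD_toArc]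
  congr 2
  have : (aeval (genericArc ι)).comp (aeval Q) =
      (aeval fun j => aeval (genericArc ι) (Q j) :
        MvPolynomial κ ℂ →ₐ[ℂ] PowerSeries (ArcRing ι)) := by
    apply MvPolynomial.algHom_ext
    intro j
    simp
  exact (DFunLike.congr_fun this f).symm

lemma arcMap_toArc (Q : κ → MvPolynomial ι ℂ) (f : MvPolynomial κ ℂ) :
    arcMap Q (toArc κ f) = toArc ι (aeval Q f) :=
  arcMap_iterate_arcD Q f 0

lemma arcMap_arcMap (Q : κ → MvPolynomial ι ℂ) (Q' : μ → MvPolynomial κ ℂ) (F : ArcRing μ) :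
    arcMap Q (arcMap Q' F) = arcMap (fun j => aeval Q (Q' j)) F := by
  have : (arcMap Q).comp (arcMap Q') = arcMap (fun j => aeval Q (Q' j)) := by
    apply MvPolynomial.algHom_ext
    rintro ⟨j, k⟩
    rw [AlgHom.comp_apply, arcMap_X, arcMap_X, arcMap_iterate_arcD]
  exact DFunLike.congr_fun this F

lemma arcMap_id (F : ArcRing ι) : arcMap (fun i => (X i : MvPolynomial ι ℂ)) F = F := by
  rw [arcMap]
  simp only [aeval_X]
  exact arcEval_genericArc F

end Arcs

/-! ### Polynomials with coprime leading monomials form regular sequences -/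

section Leading

variable {σ ι k : Type*} [Field k]

/-- The monomial `m` is the only one of maximal weight in `f`. -/
def HasLeading (W : σ → ℕ) (f : MvPolynomial σ k) (m : σ →₀ ℕ) : Prop :=
  coeff m f ≠ 0 ∧ ∀ u ∈ f.support, u ≠ m → Finsupp.weight W u < Finsupp.weight W m

lemma exists_mem_support_mul {p q : MvPolynomial σ k} {w : σ →₀ ℕ} (h : w ∈ (p * q).support) :
    ∃ u ∈ p.support, ∃ v ∈ q.support, w = u + v := by
  classical
  obtain ⟨u, hu, v, hv, rfl⟩ := Finset.mem_add.1 (support_mul p q h)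
  exact ⟨u, hu, v, hv, rfl⟩

lemma HasLeading.weight_le {W : σ → ℕ} {f : MvPolynomial σ k} {m u : σ →₀ ℕ}
    (hf : HasLeading W f m) (hu : u ∈ f.support) :
    Finsupp.weight W u ≤ Finsupp.weight W m := by
  by_cases h : u = m
  · rw [h]
  · exact (hf.2 u hu h).le

/-- Every non-leading monomial of `f` has strictly smaller weight, so only the leading one
contributes in top weight. Ties among the monomials of `p` are allowed: the weight is not assumed to
be a monomial order. -/
lemma HasLeading.coeff_mul {W : σ → ℕ} {f p : MvPolynomial σ k} {m v w : σ →₀ ℕ}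
    (hf : HasLeading W f m) (hp : ∀ u ∈ p.support, Finsupp.weight W u ≤ Finsupp.weight W v)
    (hw : Finsupp.weight W v + Finsupp.weight W m ≤ Finsupp.weight W w) :
    coeff w (p * f) = coeff w (p * monomial m (coeff m f)) := by
  classical
  have hr : coeff w (p * (f - monomial m (coeff m f))) = 0 := by
    by_contra hne
    obtain ⟨a, ha, b, hb, rfl⟩ := exists_mem_support_mul (mem_support_iff.2 hne)
    have hbm : b ≠ m := by
      rintro rfl
      simp at hb
    have hbf : b ∈ f.support := by
      rw [mem_support_iff, coeff_sub, coeff_monomial, if_neg (Ne.symm hbm), sub_zero] at hb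
      exact mem_support_iff.2 hb
    have h1 := hp a ha
    have h2 := hf.2 b hbf hbm
    rw [map_add] at hw
    omega
  rwa [mul_sub, coeff_sub, sub_eq_zero] at hr

lemma HasLeading.mul {W : σ → ℕ} {f g : MvPolynomial σ k} {m n : σ →₀ ℕ}
    (hf : HasLeading W f m) (hg : HasLeading W g n) : HasLeading W (f * g) (m + n) := by
  classical
  constructor
  · rw [hg.coeff_mul (v := m) (fun u hu => hf.weight_le hu) (by rw [map_add]),
      coeff_mul_monomial]
    exact mul_ne_zero hf.1 hg.1
  · intro w hw hne
    obtain ⟨a, ha, b, hb, rfl⟩ := exists_mem_support_mul hw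
    have h1 := hf.weight_le ha
    have h2 := hg.weight_le hb
    rw [map_add, map_add]
    by_cases ham : a = m
    · have := hg.2 b hb (fun h => hne (by rw [ham, h]))
      omega
    · have := hf.2 a ha ham
      omega

lemma HasLeading.pow {W : σ → ℕ} {f : MvPolynomial σ k} {m : σ →₀ ℕ}
    (hf : HasLeading W f m) (N : ℕ) : HasLeading W (f ^ N) (N • m) := by
  classical
  induction N with
  | zero =>
    refine ⟨by simp, fun u hu hne => ?_⟩
    rw [pow_zero, mem_support_iff, coeff_one, zero_smul] at *
    exact absurd (if_neg (Ne.symm hne)) hu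
  | succ N ih =>
    rw [pow_succ, succ_nsmul]
    exact ih.mul hf

/-- The polynomials none of whose monomials is divisible by a monomial `m i`, `i ∈ T`. -/
def reducedPolynomials (k : Type*) [Field k] (m : ι → σ →₀ ℕ) (T : Finset ι) :
    Submodule k (MvPolynomial σ k) where
  carrier := {p | ∀ u ∈ p.support, ∀ i ∈ T, ¬ m i ≤ u}
  add_mem' := by
    classical
    intro p q hp hq u hu
    rcases Finset.mem_union.1 (support_add hu) with h | h
    · exact hp u h
    · exact hq u h
  zero_mem' := by simp
  smul_mem' := by
    intro c p hp u hu
    exact hp u (support_smul hu)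

variable {W : σ → ℕ} {f : ι → MvPolynomial σ k} {m : ι → σ →₀ ℕ}

/-- Division algorithm: if `m i` divides the monomial, subtracting a multiple of `f i` replaces it
by monomials of smaller weight, so induction on the weight terminates. -/
lemma monomial_mem_reduced_sup {T : Finset ι} (hf : ∀ i ∈ T, HasLeading W (f i) (m i))
    (u : σ →₀ ℕ) (c : k) :
    monomial u c ∈ reducedPolynomials k m T ⊔ (Ideal.span (f '' T)).restrictScalars k := by
  classical
  induction hn : Finsupp.weight W u using Nat.strong_induction_on generalizing u c with
  | _ n ih =>
    by_cases h : ∃ i ∈ T, m i ≤ u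
    · obtain ⟨i, hi, hle⟩ := h
      have ha := (hf i hi).1
      set a := coeff (m i) (f i) with ha'
      set p := monomial (u - m i) (c / a) with hp
      have hmon : p * monomial (m i) a = monomial u c := by
        rw [hp, monomial_mul, tsub_add_cancel_of_le hle, div_mul_cancel₀ _ ha]
      have hsum : monomial u c = p * f i - p * (f i - monomial (m i) a) := by
        rw [← hmon]
        ring
      rw [hsum]
      refine Submodule.sub_mem _ (Submodule.mem_sup_right ?_) ?_
      · exact Ideal.mul_mem_left _ _ (Ideal.subset_span ⟨i, hi, rfl⟩)
      · rw [as_sum (p * (f i - monomial (m i) a))]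
        refine Submodule.sum_mem _ fun w hw => ih _ ?_ w _ rfl
        obtain ⟨x, hx, b, hb, rfl⟩ := exists_mem_support_mul hw
        have hxu : x = u - m i := by
          have := support_monomial_subset hx
          simpa using this
        have hbm : b ≠ m i := by
          rintro rfl
          simp [ha'] at hb
        have hbf : b ∈ (f i).support := by
          rw [mem_support_iff, coeff_sub, coeff_monomial, if_neg (Ne.symm hbm), sub_zero] at hb
          exact mem_support_iff.2 hb
        have h2 := (hf i hi).2 b hbf hbm
        have h3 : Finsupp.weight W (u - m i) + Finsupp.weight W (m i) = n := by
          rw [← map_add, tsub_add_cancel_of_le hle, hn]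
        rw [map_add, hxu]
        omega
    · push Not at h
      refine Submodule.mem_sup_left fun w hw i hi => ?_
      have := support_monomial_subset hw
      rw [Finset.mem_singleton] at this
      rw [this]
      exact h i hi

lemma exists_reduced {T : Finset ι} (hf : ∀ i ∈ T, HasLeading W (f i) (m i))
    (p : MvPolynomial σ k) :
    ∃ q ∈ reducedPolynomials k m T, ∃ z ∈ Ideal.span (f '' T), p = q + z := by
  have : p ∈ reducedPolynomials k m T ⊔ (Ideal.span (f '' T)).restrictScalars k := by
    rw [as_sum p]
    exact Submodule.sum_mem _ fun u _ => monomial_mem_reduced_sup hf u _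
  obtain ⟨q, hq, z, hz, h⟩ := Submodule.mem_sup.1 this
  exact ⟨q, hq, z, hz, h.symm⟩

/-- Multiplying by a leading monomial coprime to all `m j` cannot create divisibility by some `m j`.
Hence the top part of `q * f i` is visibly a multiple of `m i`, yet contains a monomial outside the
ideal of the `m j`. -/
lemma reduced_mul_top {T : Finset ι} {i : ι} {q : MvPolynomial σ k}
    (hi : HasLeading W (f i) (m i)) (hd : ∀ j ∈ T, ∀ x, m j x = 0 ∨ m i x = 0)
    (hq : q ∈ reducedPolynomials k m T) (hq0 : q ≠ 0) :
    ∃ v ∈ (q * f i).support,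
      (∀ w ∈ (q * f i).support, Finsupp.weight W w ≤ Finsupp.weight W v) ∧
      (∀ w ∈ (q * f i).support, Finsupp.weight W w = Finsupp.weight W v → m i ≤ w) ∧
      ∀ j ∈ T, ¬ m j ≤ v := by
  obtain ⟨a, ha, hmax⟩ := Finset.exists_max_image q.support (Finsupp.weight W)
    (support_nonempty.2 hq0)
  refine ⟨a + m i, ?_, ?_, ?_, ?_⟩
  · rw [mem_support_iff, hi.coeff_mul hmax (by rw [map_add]), coeff_mul_monomial]
    exact mul_ne_zero (mem_support_iff.1 ha) hi.1
  · intro w hw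
    obtain ⟨x, hx, b, hb, rfl⟩ := exists_mem_support_mul hw
    rw [map_add, map_add]
    exact add_le_add (hmax x hx) (hi.weight_le hb)
  · intro w hw hwt
    rw [mem_support_iff, hi.coeff_mul hmax (by rw [hwt, map_add]), coeff_mul_monomial'] at hw
    by_contra hle
    exact hw (if_neg hle)
  · intro j hj hle
    refine hq a ha j hj fun x => ?_
    have h1 := hle x
    rw [Finsupp.add_apply] at h1
    rcases hd j hj x with h | h <;> omega

/-- The monomials `m i` generate the ideal of leading terms. -/
theorem exists_le_of_mem_span {T : Finset ι} (hf : ∀ i ∈ T, HasLeading W (f i) (m i))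
    (hd : ∀ i ∈ T, ∀ j ∈ T, i ≠ j → ∀ x, m i x = 0 ∨ m j x = 0)
    {g : MvPolynomial σ k} (hg : g ∈ Ideal.span (f '' T)) {u : σ →₀ ℕ} (hu : u ∈ g.support)
    (hmax : ∀ v ∈ g.support, Finsupp.weight W v ≤ Finsupp.weight W u) : ∃ i ∈ T, m i ≤ u := by
  classical
  induction T using Finset.induction_on generalizing g u with
  | empty =>
    simp only [Finset.coe_empty, Set.image_empty, Ideal.span_empty, Ideal.mem_bot] at hg
    simp [hg] at hu
  | insert i T hiT ih =>
    have hfT : ∀ i ∈ T, HasLeading W (f i) (m i) := fun j hj => hf j (Finset.mem_insert_of_mem hj)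
    have ih' := @ih hfT (fun a ha b hb => hd a (Finset.mem_insert_of_mem ha) b
      (Finset.mem_insert_of_mem hb))
    rw [Finset.coe_insert, Set.image_insert_eq, Ideal.mem_span_insert] at hg
    obtain ⟨p, z, hz, rfl⟩ := hg
    -- Reducing the cofactor of `f i` modulo the other generators puts its non-reduced part into
    -- `z'`, so that the top of `q * f i` can no longer be cancelled by `z'`.
    obtain ⟨q, hq, y, hy, rfl⟩ := exists_reduced hfT p
    have hz' : y * f i + z ∈ Ideal.span (f '' T) :=
      Ideal.add_mem _ (Ideal.mul_mem_right _ _ hy) hz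
    set z' := y * f i + z with hz'def
    have hgz : (q + y) * f i + z = q * f i + z' := by rw [hz'def]; ring
    rw [hgz] at hu hmax
    by_cases hq0 : q = 0
    · rw [hq0, zero_mul, zero_add] at hu hmax
      obtain ⟨j, hj, hle⟩ := ih' hz' hu hmax
      exact ⟨j, Finset.mem_insert_of_mem hj, hle⟩
    obtain ⟨v, hv, hv1, hv2, hv3⟩ := reduced_mul_top (T := T) (hf i (Finset.mem_insert_self i T))
      (fun j hj => hd j (Finset.mem_insert_of_mem hj) i (Finset.mem_insert_self i T)
        (fun h => hiT (h ▸ hj))) hq hq0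
    have hzsupp : ∀ w ∈ z'.support, w ∈ (q * f i + z').support ∨ w ∈ (q * f i).support := by
      intro w hw
      by_contra hcon
      push Not at hcon
      have h1 := notMem_support_iff.1 hcon.1
      have h2 := notMem_support_iff.1 hcon.2
      rw [coeff_add, h2, zero_add] at h1
      exact mem_support_iff.1 hw h1
    -- Otherwise `v` cancels against `z'`, where it is of top weight; by induction some `m j`
    -- divides it, which reducedness of `q` excludes.
    have hvu : Finsupp.weight W v ≤ Finsupp.weight W u := by
      by_contra hlt
      have hvg : v ∉ (q * f i + z').support := fun h => hlt (hmax v h)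
      have hvz : v ∈ z'.support := by
        rw [mem_support_iff] at hv ⊢
        rw [notMem_support_iff, coeff_add] at hvg
        intro h
        rw [h, add_zero] at hvg
        exact hv hvg
      obtain ⟨j, hj, hle⟩ := ih' hz' hvz (fun w hw => by
        rcases hzsupp w hw with h | h
        · exact (hmax w h).trans (not_le.1 hlt).le
        · exact hv1 w h)
      exact hv3 j hj hle
    by_cases huq : u ∈ (q * f i).support
    · exact ⟨i, Finset.mem_insert_self i T, hv2 u huq (le_antisymm (hv1 u huq) hvu)⟩
    · have huz : u ∈ z'.support := by
        rw [mem_support_iff] at hu ⊢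
        rwa [coeff_add, notMem_support_iff.1 huq, zero_add] at hu
      obtain ⟨j, hj, hle⟩ := ih' hz' huz (fun w hw => by
        rcases hzsupp w hw with h | h
        · exact hmax w h
        · exact (hv1 w h).trans hvu)
      exact ⟨j, Finset.mem_insert_of_mem hj, hle⟩

/-- Polynomials with pairwise coprime leading monomials form a regular sequence in any order. -/
theorem mem_span_of_mul_mem {T : Finset ι} {i : ι}
    (hf : ∀ i ∈ T, HasLeading W (f i) (m i)) (hfi : HasLeading W (f i) (m i))
    (hd : ∀ i ∈ T, ∀ j ∈ T, i ≠ j → ∀ x, m i x = 0 ∨ m j x = 0)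
    (hdi : ∀ j ∈ T, ∀ x, m j x = 0 ∨ m i x = 0)
    {h : MvPolynomial σ k} (hh : h * f i ∈ Ideal.span (f '' T)) : h ∈ Ideal.span (f '' T) := by
  obtain ⟨q, hq, z, hz, rfl⟩ := exists_reduced hf h
  have hq' : q * f i ∈ Ideal.span (f '' T) := by
    have h1 := Ideal.sub_mem _ hh (Ideal.mul_mem_right (f i) _ hz)
    rwa [add_mul, add_sub_cancel_right] at h1
  by_cases hq0 : q = 0
  · rwa [hq0, zero_add]
  · obtain ⟨v, hv, hv1, -, hv3⟩ := reduced_mul_top hfi hdi hq hq0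
    obtain ⟨j, hj, hle⟩ := exists_le_of_mem_span hf hd hq' hv hv1
    exact absurd hle (hv3 j hj)

end Leading

/-! ### Regular sequences indexed by the natural numbers -/

section Leading

variable {σ ι k : Type*} [Field k]

/-- An ideal membership involves finitely many generators, so the weight may depend on how many of
them have to be controlled. -/
theorem mem_span_of_mul_mem_of_forall_bound {f : ℕ → MvPolynomial σ k} {m : ℕ → σ →₀ ℕ}
    (hf : ∀ n : ℕ, ∃ W : σ → ℕ, ∀ i ≤ n, HasLeading W (f i) (m i))
    (hd : ∀ i j, i ≠ j → ∀ x, m i x = 0 ∨ m j x = 0) {S : Set ℕ} {i : ℕ} (hi : i ∉ S)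
    {h : MvPolynomial σ k} (hh : h * f i ∈ Ideal.span (f '' S)) : h ∈ Ideal.span (f '' S) := by
  classical
  obtain ⟨T', hT', hx⟩ := Submodule.mem_span_finite_of_mem_span hh
  obtain ⟨T, hTS, rfl⟩ := Finset.subset_set_image_iff.1 hT'
  rw [Finset.coe_image] at hx
  obtain ⟨W, hW⟩ := hf (max i (T.sup id))
  have hT : ∀ j ∈ T, HasLeading W (f j) (m j) := fun j hj =>
    hW j (le_max_of_le_right (Finset.le_sup (f := id) hj))
  have key := mem_span_of_mul_mem hT (hW i (le_max_left _ _)) (fun a _ b _ hab => hd a b hab)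
    (fun j hj => hd j i fun hji => hi (hji ▸ hTS hj)) hx
  exact Ideal.span_mono (Set.image_mono hTS) key

/-- The polynomials all of whose monomials have weight less than `n`. -/
def lowerPolynomials (k : Type*) [Field k] (W : σ → ℕ) (n : ℕ) :
    Submodule k (MvPolynomial σ k) where
  carrier := {p | ∀ u ∈ p.support, Finsupp.weight W u < n}
  add_mem' := by
    classical
    intro p q hp hq u hu
    rcases Finset.mem_union.1 (support_add hu) with h | h
    · exact hp u h
    · exact hq u h
  zero_mem' := by simp
  smul_mem' := by
    intro c p hp u hu
    exact hp u (support_smul hu)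

lemma monomial_mem_lower {W : σ → ℕ} {n : ℕ} {u : σ →₀ ℕ} (h : Finsupp.weight W u < n) (c : k) :
    monomial u c ∈ lowerPolynomials k W n := by
  intro v hv
  have := support_monomial_subset hv
  rw [Finset.mem_singleton] at this
  rwa [this]

lemma hasLeading_of_sub_mem {W : σ → ℕ} {f : MvPolynomial σ k} {m : σ →₀ ℕ} {c : k} (hc : c ≠ 0)
    (h : f - monomial m c ∈ lowerPolynomials k W (Finsupp.weight W m)) : HasLeading W f m := by
  classical
  have hm : coeff m (f - monomial m c) = 0 := by
    by_contra hne
    exact lt_irrefl _ (h m (mem_support_iff.2 hne))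
  refine ⟨?_, fun u hu hne => h u ?_⟩
  · rw [coeff_sub, coeff_monomial, if_pos rfl, sub_eq_zero] at hm
    rwa [hm]
  · rw [mem_support_iff, coeff_sub, coeff_monomial, if_neg (Ne.symm hne), sub_zero]
    exact mem_support_iff.1 hu

end Leading

/-! ### Monomials in the coefficients of products of generic arcs -/

section GenericProducts

variable {ι : Type*}

lemma genericArc_coeff (a : ι) (k : ℕ) : PowerSeries.coeff k (genericArc ι a) =
    monomial (Finsupp.single (a, k) 1) (k.factorial : ℂ)⁻¹ := by
  rw [genericArc, PowerSeries.coeff_mk, X, C_mul_monomial, mul_one]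

lemma coeff_mul_genericArc (a b : ι) (k : ℕ) :
    PowerSeries.coeff k (genericArc ι a * genericArc ι b) =
      ∑ p ∈ Finset.HasAntidiagonal.antidiagonal k,
        monomial (Finsupp.single (a, p.1) 1 + Finsupp.single (b, p.2) 1)
          ((p.1.factorial : ℂ)⁻¹ * (p.2.factorial : ℂ)⁻¹) := by
  simp only [PowerSeries.coeff_mul, genericArc_coeff, monomial_mul]

lemma coeff_mul_mul_genericArc (a b c : ι) (k : ℕ) :
    PowerSeries.coeff k (genericArc ι a * genericArc ι b * genericArc ι c) =
      ∑ p ∈ Finset.HasAntidiagonal.antidiagonal k, ∑ q ∈ Finset.HasAntidiagonal.antidiagonal p.1,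
        monomial (Finsupp.single (a, q.1) 1 + Finsupp.single (b, q.2) 1 +
          Finsupp.single (c, p.2) 1)
          ((q.1.factorial : ℂ)⁻¹ * (q.2.factorial : ℂ)⁻¹ * (p.2.factorial : ℂ)⁻¹) := by
  rw [PowerSeries.coeff_mul]
  simp only [coeff_mul_genericArc, genericArc_coeff, Finset.sum_mul, monomial_mul]

variable {W : ι × ℕ → ℕ} {n : ℕ}

lemma coeff_mul_mem_lower {a b : ι} {k : ℕ}
    (h : ∀ i j, i + j = k → W (a, i) + W (b, j) < n) :
    PowerSeries.coeff k (genericArc ι a * genericArc ι b) ∈ lowerPolynomials ℂ W n := by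
  rw [coeff_mul_genericArc]
  refine Submodule.sum_mem _ fun p hp => monomial_mem_lower ?_ _
  rw [Finset.HasAntidiagonal.mem_antidiagonal] at hp
  simpa [Finsupp.weight_single] using h p.1 p.2 hp

lemma coeff_mul_mul_mem_lower {a b c : ι} {k : ℕ}
    (h : ∀ i j l, i + j + l = k → W (a, i) + W (b, j) + W (c, l) < n) :
    PowerSeries.coeff k (genericArc ι a * genericArc ι b * genericArc ι c) ∈
      lowerPolynomials ℂ W n := by
  rw [coeff_mul_mul_genericArc]
  refine Submodule.sum_mem _ fun p hp => Submodule.sum_mem _ fun q hq => monomial_mem_lower ?_ _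
  rw [Finset.HasAntidiagonal.mem_antidiagonal] at hp hq
  simpa [Finsupp.weight_single] using h q.1 q.2 p.2 (by rw [hq, hp])

lemma coeff_mul_sub_mem_lower {a b : ι} {i₀ j₀ : ℕ}
    (h : ∀ i j, i + j = i₀ + j₀ → ¬ (i = i₀ ∧ j = j₀) → W (a, i) + W (b, j) < n) :
    PowerSeries.coeff (i₀ + j₀) (genericArc ι a * genericArc ι b) -
      monomial (Finsupp.single (a, i₀) 1 + Finsupp.single (b, j₀) 1)
        ((i₀.factorial : ℂ)⁻¹ * (j₀.factorial : ℂ)⁻¹) ∈ lowerPolynomials ℂ W n := by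
  classical
  rw [coeff_mul_genericArc,
    ← Finset.add_sum_erase _ _
      (Finset.HasAntidiagonal.mem_antidiagonal.2 (rfl : (i₀, j₀).1 + (i₀, j₀).2 = _)),
    add_sub_cancel_left]
  refine Submodule.sum_mem _ fun p hp => monomial_mem_lower ?_ _
  rw [Finset.mem_erase, Finset.HasAntidiagonal.mem_antidiagonal] at hp
  simpa [Finsupp.weight_single] using h p.1 p.2 hp.2 (fun hh => hp.1 (Prod.ext hh.1 hh.2))

lemma coeff_mul_mul_sub_mem_lower {a b c : ι} {i₀ j₀ l₀ : ℕ}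
    (h : ∀ i j l, i + j + l = i₀ + j₀ + l₀ → ¬ (i = i₀ ∧ j = j₀ ∧ l = l₀) →
      W (a, i) + W (b, j) + W (c, l) < n) :
    PowerSeries.coeff (i₀ + j₀ + l₀) (genericArc ι a * genericArc ι b * genericArc ι c) -
      monomial (Finsupp.single (a, i₀) 1 + Finsupp.single (b, j₀) 1 + Finsupp.single (c, l₀) 1)
        ((i₀.factorial : ℂ)⁻¹ * (j₀.factorial : ℂ)⁻¹ * (l₀.factorial : ℂ)⁻¹) ∈
      lowerPolynomials ℂ W n := by
  classical
  rw [coeff_mul_mul_genericArc, ← Finset.add_sum_erase _ _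
      
      (Finset.HasAntidiagonal.mem_antidiagonal.2 (rfl : (i₀ + j₀, l₀).1 + (i₀ + j₀, l₀).2 = _)),
    ← Finset.add_sum_erase _ _
      (Finset.HasAntidiagonal.mem_antidiagonal.2 (rfl : (i₀, j₀).1 + (i₀, j₀).2 = _)),
    add_assoc, add_sub_cancel_left]
  refine Submodule.add_mem _ (Submodule.sum_mem _ fun q hq => monomial_mem_lower ?_ _)
    (Submodule.sum_mem _ fun p hp => Submodule.sum_mem _ fun q hq => monomial_mem_lower ?_ _)
  · rw [Finset.mem_erase, Finset.HasAntidiagonal.mem_antidiagonal] at hq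
    simpa [Finsupp.weight_single] using h q.1 q.2 l₀ (by rw [hq.2])
      (fun hh => hq.1 (Prod.ext hh.1 hh.2.1))
  · rw [Finset.HasAntidiagonal.mem_antidiagonal] at hq
    rw [Finset.mem_erase, Finset.HasAntidiagonal.mem_antidiagonal] at hp
    have := hp.2
    simpa [Finsupp.weight_single] using h q.1 q.2 p.2 (by rw [hq, hp.2])
      (fun hh => hp.1 (Prod.ext (by rw [← hq, hh.1, hh.2.1]) hh.2.2))

end GenericProducts

/-! ### The relation between the Gram matrix and the determinant -/

/-- The relation `d² = -4 det G` between the determinant `d = X 6` of three vectors in `𝔰𝔩₂` and the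
entries of their Gram matrix: `X 0`, `X 1`, `X 2` are the values of the quadratic form `-det`, and
`X 3`, `X 4`, `X 5` are the values of its polar form at the pairs `(2, 3)`, `(1, 3)`, `(1, 2)`. -/
def gramRelation : MvPolynomial (Fin 7) ℂ :=
  X 6 * X 6 + (4 : ℂ) • (X 0 * X 1 * X 2) + X 3 * X 4 * X 5 - X 0 * X 3 * X 3 - X 1 * X 4 * X 4 -
    X 2 * X 5 * X 5

/-- The coefficients of the power series obtained from the Gram relation. -/
def gramEquation (k : ℕ) : ArcRing (Fin 7) :=
  PowerSeries.coeff k (aeval (genericArc (Fin 7)) gramRelation)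

lemma gramEquation_eq (k : ℕ) : gramEquation k =
    PowerSeries.coeff k (genericArc (Fin 7) 6 * genericArc (Fin 7) 6) +
    (4 : ℂ) • PowerSeries.coeff k (genericArc (Fin 7) 0 * genericArc (Fin 7) 1 *
      genericArc (Fin 7) 2) +
    PowerSeries.coeff k (genericArc (Fin 7) 3 * genericArc (Fin 7) 4 * genericArc (Fin 7) 5) -
    PowerSeries.coeff k (genericArc (Fin 7) 0 * genericArc (Fin 7) 3 * genericArc (Fin 7) 3) -
    PowerSeries.coeff k (genericArc (Fin 7) 1 * genericArc (Fin 7) 4 * genericArc (Fin 7) 4) -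
    PowerSeries.coeff k (genericArc (Fin 7) 2 * genericArc (Fin 7) 5 * genericArc (Fin 7) 5) := by
  simp only [gramEquation, gramRelation, map_add, map_sub, map_mul, aeval_X, map_smul]
  rfl

/-! ### Weights and leading monomials of the Gram equations -/

/-- Shifts of the levels of the entries of the Gram matrix. -/
def gramShift : Fin 7 → ℤ := ![-3, -1, 1, 0, -1, -2, 0]

/-- The weights that single out the leading monomials of the equations `gramEquation k`. -/
def gramWeight (M : ℕ) (x : Fin 7 × ℕ) : ℕ :=
  -- Twice `3 * M - 1` is `6 * M - 2`, between the cubic maximum `6 * M - 3` at `k = 0, 2` and the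
  -- cubic maximum `6 * M` at `k = 1`. So a square of `d` leads exactly in the equations `0` and
  -- `2`.
  if x.1 = 6 then if x.2 ≤ 1 then 3 * M - 1 else 0
  else (2 * M - (3 * x.2 + gramShift x.1) ^ 2 : ℤ).toNat

lemma gramShift_bound (a : Fin 7) : -3 ≤ gramShift a ∧ gramShift a ≤ 1 := by
  fin_cases a <;> simp [gramShift]

lemma gramWeight_cast {M k n : ℕ} (hM : (3 * n + 4) ^ 2 ≤ M) (hk : k ≤ n) {a : Fin 7}
    (ha : a ≠ 6) : (gramWeight M (a, k) : ℤ) = 2 * M - (3 * k + gramShift a) ^ 2 := by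
  rw [gramWeight, if_neg ha, Int.toNat_of_nonneg]
  obtain ⟨h1, h2⟩ := gramShift_bound a
  have h3 : ((3 * (n : ℤ) + 4) ^ 2) ≤ M := by exact_mod_cast hM
  have h4 : (3 * (k : ℤ) + gramShift a) ^ 2 ≤ (3 * (n : ℤ) + 4) ^ 2 := by
    have : (k : ℤ) ≤ n := by exact_mod_cast hk
    have : (0 : ℤ) ≤ k := by positivity
    apply sq_le_sq'  <;> linarith
  have h5 : (0 : ℤ) ≤ (3 * (n : ℤ) + 4) ^ 2 := sq_nonneg _
  change 0 ≤ 2 * (M : ℤ) - (3 * (k : ℤ) + gramShift a) ^ 2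
  linarith

/-- The shifts in each cubic term of the Gram relation add up to `-3`, so the three shifted levels
have sum `3 (k - 1)`. The weight is concave in the shifted level, hence maximal when all three equal
`k - 1`. The bound on `M` keeps the weights out of the truncation at zero. -/
lemma gramWeight_cubic_le {M n i j l k : ℕ} (hM : (3 * n + 4) ^ 2 ≤ M) (hk : k ≤ n)
    (h : i + j + l = k) {a b c : Fin 7} (ha : a ≠ 6) (hb : b ≠ 6) (hc : c ≠ 6)
    (hs : gramShift a + gramShift b + gramShift c = -3) :
    ((gramWeight M (a, i) + gramWeight M (b, j) + gramWeight M (c, l) : ℕ) : ℤ) ≤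
      6 * M - 3 * (k - 1) ^ 2 := by
  push_cast
  rw [gramWeight_cast hM (by omega) ha, gramWeight_cast hM (by omega) hb,
    gramWeight_cast hM (by omega) hc]
  have hz : (3 * (i : ℤ) + gramShift a) + (3 * j + gramShift b) + (3 * l + gramShift c) =
      3 * (k - 1) := by
    rw [← h]
    push_cast
    linarith
  set x := 3 * (i : ℤ) + gramShift a
  set y := 3 * (j : ℤ) + gramShift b
  have : 3 * (l : ℤ) + gramShift c = 3 * (k - 1) - x - y := by linarith
  rw [this]
  nlinarith [sq_nonneg (x - (k - 1)), sq_nonneg (y - (k - 1)),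
    sq_nonneg (x + y - 2 * (k - 1))]

/-- Strict concavity: equality in the bound forces all shifted levels to be `k - 1`. -/
lemma gramWeight_cubic_lt {M n i j l k : ℕ} (hM : (3 * n + 4) ^ 2 ≤ M) (hk : k ≤ n)
    (h : i + j + l = k) {a b c : Fin 7} (ha : a ≠ 6) (hb : b ≠ 6) (hc : c ≠ 6)
    (hs : gramShift a + gramShift b + gramShift c = -3)
    (hne : ¬ (3 * (i : ℤ) + gramShift a = k - 1 ∧ 3 * (j : ℤ) + gramShift b = k - 1 ∧
      3 * (l : ℤ) + gramShift c = k - 1)) :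
    ((gramWeight M (a, i) + gramWeight M (b, j) + gramWeight M (c, l) : ℕ) : ℤ) <
      6 * M - 3 * (k - 1) ^ 2 := by
  push_cast
  rw [gramWeight_cast hM (by omega) ha, gramWeight_cast hM (by omega) hb,
    gramWeight_cast hM (by omega) hc]
  have hz : (3 * (i : ℤ) + gramShift a) + (3 * j + gramShift b) + (3 * l + gramShift c) =
      3 * (k - 1) := by
    rw [← h]
    push_cast
    linarith
  set x := 3 * (i : ℤ) + gramShift a
  set y := 3 * (j : ℤ) + gramShift b
  have hl : 3 * (l : ℤ) + gramShift c = 3 * (k - 1) - x - y := by linarith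
  rw [hl] at hne ⊢
  have hpos : 0 < (x - (k - 1)) ^ 2 + (y - (k - 1)) ^ 2 := by
    by_contra hcon
    have h1 : (x - (k - 1)) ^ 2 = 0 := by
      nlinarith [sq_nonneg (x - (k - 1)), sq_nonneg (y - (k - 1))]
    have h2 : (y - (k - 1)) ^ 2 = 0 := by
      nlinarith [sq_nonneg (x - (k - 1)), sq_nonneg (y - (k - 1))]
    have h3 := pow_eq_zero_iff (two_ne_zero) |>.1 h1
    have h4 := pow_eq_zero_iff (two_ne_zero) |>.1 h2
    exact hne ⟨by linarith, by linarith, by linarith⟩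
  nlinarith [sq_nonneg (x + y - 2 * (k - 1))]

/-- For `k = 1` the product has weight at most `6 * M - 2`, against a bound of `6 * M`. For `k ≥ 3`
at most one of the two factors has level at most `1`, so the total is at most `3 * M - 1`, while `(k
- 1)² ≤ M`. -/
lemma gramWeight_quadratic_lt {M n i j k : ℕ} (hM : (3 * n + 4) ^ 2 ≤ M) (hk : k ≤ n)
    (h : i + j = k) (h0 : k ≠ 0) (h2 : k ≠ 2) :
    ((gramWeight M (6, i) + gramWeight M (6, j) : ℕ) : ℤ) < 6 * M - 3 * (k - 1) ^ 2 := by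
  have hM' : ((3 * (n : ℤ) + 4) ^ 2) ≤ M := by exact_mod_cast hM
  have hk' : (k : ℤ) ≤ n := by exact_mod_cast hk
  have hk0 : (0 : ℤ) ≤ k := by positivity
  have hM1 : 1 ≤ M := le_trans (Nat.one_le_pow _ _ (by omega)) hM
  have hb : ∀ i, gramWeight M (6, i) ≤ 3 * M - 1 := by
    intro i
    simp only [gramWeight, if_true]
    split_ifs <;> omega
  by_cases hk1 : k = 1
  · have h3 := hb i
    have h4 := hb j
    rw [hk1]
    push_cast
    omega
  · have : gramWeight M (6, i) + gramWeight M (6, j) ≤ 3 * M - 1 := by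
      by_cases hi : i ≤ 1
      · have hj : gramWeight M (6, j) = 0 := by
          simp only [gramWeight, if_true]
          rw [if_neg (by omega)]
        rw [hj]
        exact hb i
      · have hi : gramWeight M (6, i) = 0 := by
          simp only [gramWeight, if_true]
          rw [if_neg (by omega)]
        rw [hi, zero_add]
        exact hb j
    have h5 : 3 * ((k : ℤ) - 1) ^ 2 ≤ 3 * M := by nlinarith
    have h6 : ((gramWeight M (6, i) + gramWeight M (6, j) : ℕ) : ℤ) ≤ 3 * M - 1 := by omega
    linarith

/-- The leading monomials of `gramEquation k`. -/
def gramExponent (k : ℕ) : Fin 7 × ℕ →₀ ℕ :=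
  -- By concavity the cubic candidates at `k = 0` and `k = 2` would be `X (1, 0) * X (4, 0)²` and `X
  -- (2, 0) * X (5, 1)²`. Both share a variable with the leading monomial of the second minor, and
  -- are therefore outweighed by squares of `d`. For the other `k` the residue modulo `3` decides
  -- which term can have all shifted levels equal to `k - 1`.
  if k = 0 then Finsupp.single (6, 0) 1 + Finsupp.single (6, 0) 1
  else if k = 2 then Finsupp.single (6, 1) 1 + Finsupp.single (6, 1) 1
  else if k % 3 = 0 then
    Finsupp.single (1, k / 3) 1 + Finsupp.single (4, k / 3) 1 + Finsupp.single (4, k / 3) 1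
  else if k % 3 = 1 then
    Finsupp.single (0, k / 3 + 1) 1 + Finsupp.single (3, k / 3) 1 + Finsupp.single (3, k / 3) 1
  else Finsupp.single (2, k / 3) 1 + Finsupp.single (5, k / 3 + 1) 1 +
    Finsupp.single (5, k / 3 + 1) 1

lemma gramEquation_hasLeading_of_eq {M n k : ℕ} (hM : (3 * n + 4) ^ 2 ≤ M) (hk : k ≤ n)
    {e : ℕ} (he : k = e + e) (he1 : e ≤ 1) :
    HasLeading (gramWeight M) (gramEquation k)
      (Finsupp.single (6, e) 1 + Finsupp.single (6, e) 1) := by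
  have hM1 : 1 ≤ M := le_trans (Nat.one_le_pow _ _ (by omega)) hM
  have hwe : ∀ i, i ≤ 1 → gramWeight M (6, i) = 3 * M - 1 := by
    intro i hi
    simp [gramWeight, hi]
  have hw0 : ∀ i, 1 < i → gramWeight M (6, i) = 0 := by
    intro i hi
    simp only [gramWeight, if_true]
    rw [if_neg (by omega)]
  have hwt : Finsupp.weight (gramWeight M) (Finsupp.single ((6 : Fin 7), e) 1 +
      Finsupp.single (6, e) 1) = 6 * M - 2 := by
    rw [map_add, Finsupp.weight_single, hwe e he1]
    simp only [one_smul]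
    omega
  have hcub : ∀ a b c : Fin 7, a ≠ 6 → b ≠ 6 → c ≠ 6 →
      gramShift a + gramShift b + gramShift c = -3 →
      PowerSeries.coeff k (genericArc (Fin 7) a * genericArc (Fin 7) b * genericArc (Fin 7) c) ∈
        lowerPolynomials ℂ (gramWeight M) (6 * M - 2) := by
    intro a b c ha hb hc hs
    refine coeff_mul_mul_mem_lower fun i j l h => ?_
    have h1 := gramWeight_cubic_le hM hk h ha hb hc hs
    have h2 : ((k : ℤ) - 1) ^ 2 = 1 := by
      interval_cases e <;> simp [he]
    rw [h2] at h1
    omega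
  refine hasLeading_of_sub_mem (c := (e.factorial : ℂ)⁻¹ * (e.factorial : ℂ)⁻¹) ?_ ?_
  · have : (e.factorial : ℂ) ≠ 0 := Nat.cast_ne_zero.2 e.factorial_ne_zero
    positivity
  · have hq : PowerSeries.coeff k (genericArc (Fin 7) 6 * genericArc (Fin 7) 6) -
        monomial (Finsupp.single (6, e) 1 + Finsupp.single (6, e) 1)
        ((e.factorial : ℂ)⁻¹ * (e.factorial : ℂ)⁻¹) ∈
        lowerPolynomials ℂ (gramWeight M) (6 * M - 2) := by
      rw [he]
      refine coeff_mul_sub_mem_lower fun i j h hne => ?_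
      by_cases hi : i ≤ 1
      · rw [hw0 j (by omega), hwe i hi]
        omega
      · rw [hw0 i (by omega)]
        by_cases hj : j ≤ 1
        · rw [hwe j hj]
          omega
        · rw [hw0 j (by omega)]
          omega
    rw [hwt, gramEquation_eq]
    have key := Submodule.sub_mem _ (Submodule.sub_mem _ (Submodule.sub_mem _ (Submodule.add_mem _
      (Submodule.add_mem _ hq (Submodule.smul_mem _ (4 : ℂ)
        (hcub 0 1 2 (by decide) (by decide) (by decide) (by decide))))
      (hcub 3 4 5 (by decide) (by decide) (by decide) (by decide)))
      (hcub 0 3 3 (by decide) (by decide) (by decide) (by decide)))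
      (hcub 1 4 4 (by decide) (by decide) (by decide) (by decide)))
      (hcub 2 5 5 (by decide) (by decide) (by decide) (by decide))
    convert key using 1
    abel

section

variable {M n k : ℕ}

lemma gramEquation_quadratic_mem (hM : (3 * n + 4) ^ 2 ≤ M) (hk : k ≤ n) (h0 : k ≠ 0)
    (h2 : k ≠ 2) {N : ℕ} (hN : (N : ℤ) = 6 * M - 3 * (k - 1) ^ 2) :
    PowerSeries.coeff k (genericArc (Fin 7) 6 * genericArc (Fin 7) 6) ∈
      lowerPolynomials ℂ (gramWeight M) N := by
  refine coeff_mul_mem_lower fun i j h => ?_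
  have := gramWeight_quadratic_lt hM hk h h0 h2
  omega

/-- The last hypothesis is a congruence obstruction modulo `3`: the shifts of this term do not allow
all shifted levels to be `k - 1`, so the maximal weight is not attained. -/
lemma gramEquation_cubic_mem (hM : (3 * n + 4) ^ 2 ≤ M) (hk : k ≤ n) {N : ℕ}
    (hN : (N : ℤ) = 6 * M - 3 * (k - 1) ^ 2) {a b c : Fin 7} (ha : a ≠ 6) (hb : b ≠ 6)
    (hc : c ≠ 6) (hs : gramShift a + gramShift b + gramShift c = -3)
    (hne : ∀ i j l : ℤ, ¬ (3 * i + gramShift a = k - 1 ∧ 3 * j + gramShift b = k - 1 ∧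
      3 * l + gramShift c = k - 1)) :
    PowerSeries.coeff k (genericArc (Fin 7) a * genericArc (Fin 7) b * genericArc (Fin 7) c) ∈
      lowerPolynomials ℂ (gramWeight M) N := by
  refine coeff_mul_mul_mem_lower fun i j l h => ?_
  have := gramWeight_cubic_lt hM hk h ha hb hc hs (hne i j l)
  omega

lemma gramEquation_cubic_sub_mem (hM : (3 * n + 4) ^ 2 ≤ M) (hk : k ≤ n) {N : ℕ}
    (hN : (N : ℤ) = 6 * M - 3 * (k - 1) ^ 2) {a b : Fin 7} (ha : a ≠ 6) (hb : b ≠ 6)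
    (hs : gramShift a + gramShift b + gramShift b = -3) {i₀ j₀ : ℕ}
    (hi : 3 * (i₀ : ℤ) + gramShift a = k - 1) (hj : 3 * (j₀ : ℤ) + gramShift b = k - 1) :
    PowerSeries.coeff k (genericArc (Fin 7) a * genericArc (Fin 7) b * genericArc (Fin 7) b) -
      monomial (Finsupp.single (a, i₀) 1 + Finsupp.single (b, j₀) 1 + Finsupp.single (b, j₀) 1)
        ((i₀.factorial : ℂ)⁻¹ * (j₀.factorial : ℂ)⁻¹ * (j₀.factorial : ℂ)⁻¹) ∈
      lowerPolynomials ℂ (gramWeight M) N := by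
  have hk' : k = i₀ + j₀ + j₀ := by omega
  rw [hk'] at hk hN hi hj ⊢
  refine coeff_mul_mul_sub_mem_lower fun i j l h hne => ?_
  have := gramWeight_cubic_lt hM hk h ha hb hb hs (by
    rintro ⟨h1, h2, h3⟩
    exact hne ⟨by omega, by omega, by omega⟩)
  omega

lemma gramWeight_exponent (hM : (3 * n + 4) ^ 2 ≤ M) {a b : Fin 7} (ha : a ≠ 6)
    (hb : b ≠ 6) {i₀ j₀ : ℕ} (hi0 : i₀ ≤ n) (hj0 : j₀ ≤ n)
    (hi : 3 * (i₀ : ℤ) + gramShift a = k - 1)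
    (hj : 3 * (j₀ : ℤ) + gramShift b = k - 1) :
    ((Finsupp.weight (gramWeight M) (Finsupp.single (a, i₀) 1 + Finsupp.single (b, j₀) 1 +
      Finsupp.single (b, j₀) 1) : ℕ) : ℤ) = 6 * M - 3 * (k - 1) ^ 2 := by
  simp only [map_add, Finsupp.weight_single, one_smul]
  push_cast
  rw [gramWeight_cast hM hi0 ha, gramWeight_cast hM hj0 hb, hi, hj]
  ring

end

lemma gramEquation_hasLeading {M n k : ℕ} (hM : (3 * n + 4) ^ 2 ≤ M) (hk : k ≤ n) :
    HasLeading (gramWeight M) (gramEquation k) (gramExponent k) := by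
  unfold gramExponent
  split_ifs with h0 h2 h3 h4
  · exact gramEquation_hasLeading_of_eq hM hk (e := 0) (by omega) (by omega)
  · exact gramEquation_hasLeading_of_eq hM hk (e := 1) (by omega) (by omega)
  all_goals
    have hf : ∀ e : ℕ, (e.factorial : ℂ) ≠ 0 := fun e => Nat.cast_ne_zero.2 e.factorial_ne_zero
    have s0 : gramShift 0 = -3 := rfl
    have s1 : gramShift 1 = -1 := rfl
    have s2 : gramShift 2 = 1 := rfl
    have s3 : gramShift 3 = 0 := rfl
    have s4 : gramShift 4 = -1 := rfl
    have s5 : gramShift 5 = -2 := rfl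
  · have hi : 3 * ((k / 3 : ℕ) : ℤ) + gramShift 1 = k - 1 := by rw [s1]; omega
    have hj : 3 * ((k / 3 : ℕ) : ℤ) + gramShift 4 = k - 1 := by rw [s4]; omega
    have hN := gramWeight_exponent hM (a := 1) (b := 4) (by decide) (by decide)
      (by omega) (by omega) hi hj
    refine hasLeading_of_sub_mem (c := -(((k / 3).factorial : ℂ)⁻¹ * ((k / 3).factorial : ℂ)⁻¹ *
      ((k / 3).factorial : ℂ)⁻¹)) (by simp [hf]) ?_
    rw [map_neg, sub_neg_eq_add, gramEquation_eq]
    have key := Submodule.sub_mem _ (Submodule.sub_mem _ (Submodule.sub_mem _ (Submodule.add_mem _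
      (Submodule.add_mem _ (gramEquation_quadratic_mem hM hk h0 h2 hN) (Submodule.smul_mem _ (4 : ℂ)
        (gramEquation_cubic_mem hM hk hN (a := 0) (b := 1) (c := 2) (by decide) (by decide)
          (by decide) (by decide) (by rw [s0, s1, s2]; omega))))
      (gramEquation_cubic_mem hM hk hN (a := 3) (b := 4) (c := 5) (by decide) (by decide)
          (by decide) (by decide) (by rw [s3, s4, s5]; omega)))
      (gramEquation_cubic_mem hM hk hN (a := 0) (b := 3) (c := 3) (by decide) (by decide)
          (by decide) (by decide) (by rw [s0, s3]; omega)))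
      (gramEquation_cubic_sub_mem hM hk hN (a := 1) (b := 4) (by decide) (by decide) (by decide)
        hi hj))
      (gramEquation_cubic_mem hM hk hN (a := 2) (b := 5) (c := 5) (by decide) (by decide)
          (by decide) (by decide) (by rw [s2, s5]; omega))
    convert key using 1
    abel
  · have hi : 3 * ((k / 3 + 1 : ℕ) : ℤ) + gramShift 0 = k - 1 := by rw [s0]; omega
    have hj : 3 * ((k / 3 : ℕ) : ℤ) + gramShift 3 = k - 1 := by rw [s3]; omega
    have hN := gramWeight_exponent hM (a := 0) (b := 3) (by decide) (by decide)
      (by omega) (by omega) hi hj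
    refine hasLeading_of_sub_mem (c := -(((k / 3 + 1).factorial : ℂ)⁻¹ *
      ((k / 3).factorial : ℂ)⁻¹ * ((k / 3).factorial : ℂ)⁻¹)) (by simp [hf]) ?_
    rw [map_neg, sub_neg_eq_add, gramEquation_eq]
    have key := Submodule.sub_mem _ (Submodule.sub_mem _ (Submodule.sub_mem _ (Submodule.add_mem _
      (Submodule.add_mem _ (gramEquation_quadratic_mem hM hk h0 h2 hN) (Submodule.smul_mem _ (4 : ℂ)
        (gramEquation_cubic_mem hM hk hN (a := 0) (b := 1) (c := 2) (by decide) (by decide)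
          (by decide) (by decide) (by rw [s0, s1, s2]; omega))))
      (gramEquation_cubic_mem hM hk hN (a := 3) (b := 4) (c := 5) (by decide) (by decide)
          (by decide) (by decide) (by rw [s3, s4, s5]; omega)))
      (gramEquation_cubic_sub_mem hM hk hN (a := 0) (b := 3) (by decide) (by decide) (by decide)
        hi hj))
      (gramEquation_cubic_mem hM hk hN (a := 1) (b := 4) (c := 4) (by decide) (by decide)
          (by decide) (by decide) (by rw [s1, s4]; omega)))
      (gramEquation_cubic_mem hM hk hN (a := 2) (b := 5) (c := 5) (by decide) (by decide)
          (by decide) (by decide) (by rw [s2, s5]; omega))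
    convert key using 1
    abel
  · have hi : 3 * ((k / 3 : ℕ) : ℤ) + gramShift 2 = k - 1 := by rw [s2]; omega
    have hj : 3 * ((k / 3 + 1 : ℕ) : ℤ) + gramShift 5 = k - 1 := by rw [s5]; omega
    have hN := gramWeight_exponent hM (a := 2) (b := 5) (by decide) (by decide)
      (by omega) (by omega) hi hj
    refine hasLeading_of_sub_mem (c := -(((k / 3).factorial : ℂ)⁻¹ *
      ((k / 3 + 1).factorial : ℂ)⁻¹ * ((k / 3 + 1).factorial : ℂ)⁻¹)) (by simp [hf]) ?_
    rw [map_neg, sub_neg_eq_add, gramEquation_eq]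
    have key := Submodule.sub_mem _ (Submodule.sub_mem _ (Submodule.sub_mem _ (Submodule.add_mem _
      (Submodule.add_mem _ (gramEquation_quadratic_mem hM hk h0 h2 hN) (Submodule.smul_mem _ (4 : ℂ)
        (gramEquation_cubic_mem hM hk hN (a := 0) (b := 1) (c := 2) (by decide) (by decide)
          (by decide) (by decide) (by rw [s0, s1, s2]; omega))))
      (gramEquation_cubic_mem hM hk hN (a := 3) (b := 4) (c := 5) (by decide) (by decide)
          (by decide) (by decide) (by rw [s3, s4, s5]; omega)))
      (gramEquation_cubic_mem hM hk hN (a := 0) (b := 3) (c := 3) (by decide) (by decide)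
          (by decide) (by decide) (by rw [s0, s3]; omega)))
      (gramEquation_cubic_mem hM hk hN (a := 1) (b := 4) (c := 4) (by decide) (by decide)
          (by decide) (by decide) (by rw [s1, s4]; omega)))
      (gramEquation_cubic_sub_mem hM hk hN (a := 2) (b := 5) (by decide) (by decide) (by decide)
        hi hj)
    convert key using 1
    abel

/-! ### Minors that extend the Gram equations to a regular sequence -/

/-- The product of the first diagonal entry with a principal `2 × 2` minor (times `4`) of the Gram
matrix. -/
def gramMinor (a b c : Fin 7) : MvPolynomial (Fin 7) ℂ :=
  X a * ((4 : ℂ) • (X a * X b) - X c * X c)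

lemma toArc_gramMinor (a b c : Fin 7) : toArc (Fin 7) (gramMinor a b c) =
    X (a, 0) * ((4 : ℂ) • (X (a, 0) * X (b, 0)) - X (c, 0) * X (c, 0)) := by
  simp [gramMinor, toArc]

/-- The inequality between the shifts says that the square of `X c` outweighs `X a * X b` at level
zero. It holds for `(0, 1, 5)` as `8 < 10` and for `(2, 0, 4)` as `2 < 10`. -/
lemma toArc_gramMinor_hasLeading {M n : ℕ} (hM : (3 * n + 4) ^ 2 ≤ M) {a b c : Fin 7} (ha : a ≠ 6)
    (hb : b ≠ 6) (hc : c ≠ 6)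
    (h : 2 * gramShift c ^ 2 < gramShift a ^ 2 + gramShift b ^ 2) :
    HasLeading (gramWeight M) (toArc (Fin 7) (gramMinor a b c))
      (Finsupp.single (a, 0) 1 + (Finsupp.single (c, 0) 1 + Finsupp.single (c, 0) 1)) := by
  rw [toArc_gramMinor]
  refine HasLeading.mul ?_ ?_
  · refine hasLeading_of_sub_mem (c := 1) one_ne_zero ?_
    rw [X, sub_self]
    exact Submodule.zero_mem _
  · refine hasLeading_of_sub_mem (c := -1) (by simp) ?_
    have : (4 : ℂ) • (X (a, 0) * X (b, 0)) - X (c, 0) * X (c, 0) -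
        monomial (Finsupp.single (c, 0) 1 + Finsupp.single (c, 0) 1) (-1) =
        (monomial (Finsupp.single (a, 0) 1 + Finsupp.single (b, 0) 1) 4 : ArcRing (Fin 7)) := by
      simp only [X, monomial_mul, smul_monomial, map_neg, mul_one, smul_eq_mul]
      abel
    rw [this]
    refine monomial_mem_lower ?_ _
    simp only [map_add, Finsupp.weight_single, one_smul]
    have h1 := gramWeight_cast hM n.zero_le ha
    have h2 := gramWeight_cast hM n.zero_le hb
    have h3 := gramWeight_cast hM n.zero_le hc
    simp only [Nat.cast_zero, mul_zero, zero_add] at h1 h2 h3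
    omega

/-- Two elements of the ideal of `2 × 2` minors of the Gram matrix, together with the equations
between the Gram matrix and the determinant. -/
def gramSequence (N : ℕ) : ℕ → ArcRing (Fin 7)
  | 0 => toArc (Fin 7) (gramMinor 0 1 5) ^ N
  | 1 => toArc (Fin 7) (gramMinor 2 0 4) ^ N
  | k + 2 => gramEquation k

/-- The leading monomials of `gramSequence`. -/
def gramSequenceExponent (N : ℕ) : ℕ → Fin 7 × ℕ →₀ ℕ
  | 0 => N • (Finsupp.single (0, 0) 1 + (Finsupp.single (5, 0) 1 + Finsupp.single (5, 0) 1))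
  | 1 => N • (Finsupp.single (2, 0) 1 + (Finsupp.single (4, 0) 1 + Finsupp.single (4, 0) 1))
  | k + 2 => gramExponent k

lemma gramSequence_hasLeading (N n : ℕ) : ∃ W : Fin 7 × ℕ → ℕ,
    ∀ i ≤ n, HasLeading W (gramSequence N i) (gramSequenceExponent N i) := by
  refine ⟨gramWeight ((3 * n + 4) ^ 2), fun i hi => ?_⟩
  match i with
  | 0 => exact (toArc_gramMinor_hasLeading le_rfl (by decide) (by decide) (by decide)
      (by decide)).pow N
  | 1 => exact (toArc_gramMinor_hasLeading le_rfl (by decide) (by decide) (by decide)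
      (by decide)).pow N
  | k + 2 => exact gramEquation_hasLeading le_rfl (by omega)

/-- The member of `gramSequence` whose leading monomial involves a given variable. -/
def gramOwner (x : Fin 7 × ℕ) : ℕ :=
  if x.1 = 0 then if x.2 = 0 then 0 else 3 * x.2
  else if x.1 = 1 then 3 * x.2 + 2
  else if x.1 = 2 then if x.2 = 0 then 1 else 3 * x.2 + 4
  else if x.1 = 3 then 3 * x.2 + 3
  else if x.1 = 4 then if x.2 = 0 then 1 else 3 * x.2 + 2
  else if x.1 = 5 then if x.2 = 0 then 0 else 3 * x.2 + 1
  else if x.2 = 0 then 2 else 4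

/-- A variable determines the one member of the sequence whose leading monomial can contain it, so
distinct leading monomials are coprime. -/
lemma gramOwner_eq {N i : ℕ} {x : Fin 7 × ℕ} (h : gramSequenceExponent N i x ≠ 0) :
    gramOwner x = i := by
  classical
  have hx : ∀ (e : ℕ) (y : Fin 7 × ℕ), Finsupp.single y e x ≠ 0 → x = y := by
    intro e y hy
    by_contra hne
    exact hy (Finsupp.single_eq_of_ne hne)
  have h3 : ∀ y z : Fin 7 × ℕ, (Finsupp.single y 1 + Finsupp.single z 1 + Finsupp.single z 1 :
      Fin 7 × ℕ →₀ ℕ) x ≠ 0 → x = y ∨ x = z := by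
    intro y z hyz
    by_contra hcon
    push Not at hcon
    apply hyz
    simp [Finsupp.single_eq_of_ne hcon.1, Finsupp.single_eq_of_ne hcon.2]
  match i with
  | 0 =>
    rw [gramSequenceExponent, Finsupp.smul_apply, ← add_assoc] at h
    rcases h3 _ _ (right_ne_zero_of_mul h) with rfl | rfl <;> rfl
  | 1 =>
    rw [gramSequenceExponent, Finsupp.smul_apply, ← add_assoc] at h
    rcases h3 _ _ (right_ne_zero_of_mul h) with rfl | rfl <;> rfl
  | k + 2 =>
    rw [gramSequenceExponent, gramExponent] at h
    split_ifs at h with h0 h2 hm0 hm1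
    · have : x = (6, 0) := by
        rw [← Finsupp.single_add] at h
        exact hx _ _ h
      subst this
      simp [gramOwner, h0]
    · have : x = (6, 1) := by
        rw [← Finsupp.single_add] at h
        exact hx _ _ h
      subst this
      simp [gramOwner, h2]
    · have hk : k / 3 ≠ 0 := by omega
      rcases h3 _ _ h with rfl | rfl
      · simp [gramOwner]
        omega
      · simp [gramOwner, hk]
        omega
    · rcases h3 _ _ h with rfl | rfl
      · simp [gramOwner]
        omega
      · simp [gramOwner]
        omega
    · have hk : k / 3 ≠ 0 := by omega
      rcases h3 _ _ h with rfl | rfl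
      · simp [gramOwner, hk]
        omega
      · simp [gramOwner]
        omega

lemma gramSequenceExponent_disjoint (N i j : ℕ) (hij : i ≠ j) (x : Fin 7 × ℕ) :
    gramSequenceExponent N i x = 0 ∨ gramSequenceExponent N j x = 0 := by
  by_contra hcon
  push Not at hcon
  exact hij ((gramOwner_eq hcon.1).symm.trans (gramOwner_eq hcon.2))

/-- The ideal of the relations between the derivatives of the entries of the Gram matrix and the
determinant. -/
def gramIdeal : Ideal (ArcRing (Fin 7)) := Ideal.span (Set.range gramEquation)

lemma gramIdeal_eq (N : ℕ) : gramIdeal = Ideal.span (gramSequence N '' {i | 2 ≤ i}) := by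
  rw [gramIdeal]
  congr 1
  ext F
  constructor
  · rintro ⟨k, rfl⟩
    exact ⟨k + 2, by simp, rfl⟩
  · rintro ⟨i, hi, rfl⟩
    obtain ⟨k, rfl⟩ := Nat.exists_eq_add_of_le' hi
    exact ⟨k, rfl⟩

theorem mem_gramIdeal_of_mul_mem {N : ℕ} {F : ArcRing (Fin 7)}
    (h : F * toArc (Fin 7) (gramMinor 0 1 5) ^ N ∈ gramIdeal) : F ∈ gramIdeal := by
  rw [gramIdeal_eq N] at h ⊢
  exact mem_span_of_mul_mem_of_forall_bound (i := 0) (gramSequence_hasLeading N)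
    (gramSequenceExponent_disjoint N) (by simp) h

theorem mem_span_gramMinor_of_mul_mem {N : ℕ} {F : ArcRing (Fin 7)}
    (h : F * toArc (Fin 7) (gramMinor 2 0 4) ^ N ∈
      Ideal.span {toArc (Fin 7) (gramMinor 0 1 5) ^ N} ⊔ gramIdeal) :
    F ∈ Ideal.span {toArc (Fin 7) (gramMinor 0 1 5) ^ N} ⊔ gramIdeal := by
  have hS : Ideal.span {toArc (Fin 7) (gramMinor 0 1 5) ^ N} ⊔ gramIdeal =
      Ideal.span (gramSequence N '' (insert 0 {i | 2 ≤ i})) := by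
    rw [gramIdeal_eq N, ← Ideal.span_union, Set.image_insert_eq, Set.insert_eq]
    rfl
  rw [hS] at h ⊢
  exact mem_span_of_mul_mem_of_forall_bound (i := 1) (gramSequence_hasLeading N)
    (gramSequenceExponent_disjoint N) (by simp) h

/-! ### Invariance under the arc group of `SL₂` -/

section General

attribute [local instance 100] LieRing.ofAssociativeRing

variable {ι V L : Type*} [Fintype ι] [AddCommGroup V] [Module ℂ V] [LieRing L] [LieAlgebra ℂ L]

lemma mem_arcInvariants_iff (ρ : L →ₗ⁅ℂ⁆ Module.End ℂ V) (b : Module.Basis ι ℂ V)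
    (F : ArcRing ι) :
    F ∈ arcInvariants ρ b ↔ ∀ (r : ℕ) (ξ : L), monomialAction ρ b r ξ F = 0 := by
  constructor
  · intro h r ξ
    have := h (Polynomial.monomial r 1 ⊗ₜ ξ)
    rwa [currentAction_monomial_tmul, one_smul] at this
  · intro h u
    induction u with
    | zero => simp
    | add u u' hu hu' => rw [map_add, Derivation.add_apply, hu, hu', add_zero]
    | tmul p ξ =>
      induction p using Polynomial.induction_on' with
      | add p p' hp hp' =>
        rw [TensorProduct.add_tmul, map_add, Derivation.add_apply, hp, hp', add_zero]
      | monomial r c =>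
        rw [currentAction_monomial_tmul, Derivation.smul_apply, h, smul_zero]

end General

/-- Chain rule for a derivation seen as a vector field: the curve only has to follow the field in
the variables that `F` involves. Complex time serves the unipotent flows, real time the
one-parameter subgroups of `SU(2)`. -/
lemma hasDerivAt_eval {𝕜 σ : Type*} [NontriviallyNormedField 𝕜] [NormedAlgebra 𝕜 ℂ]
    (δ : Derivation ℂ (MvPolynomial σ ℂ) (MvPolynomial σ ℂ)) (x : 𝕜 → σ → ℂ) (z : 𝕜) {S : Set σ}
    (hx : ∀ s ∈ S, HasDerivAt (fun w => x w s) (eval (x z) (δ (X s))) z)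
    {F : MvPolynomial σ ℂ} (hF : F ∈ supported ℂ S) :
    HasDerivAt (fun w => eval (x w) F) (eval (x z) (δ F)) z := by
  induction hF using Algebra.adjoin_induction with
  | mem F hF =>
    obtain ⟨s, hs, rfl⟩ := hF
    simpa using hx s hs
  | algebraMap c =>
    rw [Derivation.map_algebraMap]
    simpa [MvPolynomial.algebraMap_eq] using hasDerivAt_const z c
  | add p q _ _ hp hq =>
    simp only [map_add]
    exact hp.add hq
  | mul p q _ _ hp hq =>
    rw [Derivation.leibniz]
    simp only [map_mul, map_add, smul_eq_mul]
    refine (hp.mul hq).congr_deriv ?_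
    ring

lemma arcEval_eq_eval {ι : Type*} (v : ι → PowerSeries ℂ) (F : ArcRing ι) :
    arcEval v F = eval (fun p => (p.2.factorial : ℂ) * PowerSeries.coeff p.2 (v p.1)) F := rfl

/-! ### Unipotent and Weyl group elements acting on arcs -/

section Sl2

variable {n : ℕ}

lemma copiesBasis_apply (m : Fin n) (j : Fin 3) :
    copiesBasis n ⟨m, j⟩ = Pi.single m (sl2Basis j) := by
  simp [copiesBasis, Pi.basis_apply]

lemma copiesBasis_repr (v : Fin n → Sl2) (m : Fin n) (i : Fin 3) :
    (copiesBasis n).repr v ⟨m, i⟩ = sl2Coord (v m) i := by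
  simp [copiesBasis, sl2Basis, Pi.basis_repr, Module.Basis.ofEquivFun_repr_apply]

lemma sl2Basis_apply (j : Fin 3) : sl2Basis j = sl2Coord.symm (Pi.single j 1) := by
  simp [sl2Basis]

lemma dualForm_copies (ξ : Sl2) (m : Fin n) (i : Fin 3) (k : ℕ) :
    dualForm (lieCopies (LieAlgebra.ad ℂ Sl2) n) (copiesBasis n) ξ ⟨m, i⟩ k =
      -∑ j, sl2Coord ⁅ξ, sl2Basis j⁆ i • (X (⟨m, j⟩, k) : ArcRing (Σ _ : Fin n, Fin 3)) := by
  rw [dualForm, Fintype.sum_sigma, Finset.sum_eq_single m]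
  · congr 1
    refine Finset.sum_congr rfl fun j _ => ?_
    rw [copiesBasis_repr, copiesBasis_apply]
    simp [lieCopies]
  · intro m' _ hm
    refine Finset.sum_eq_zero fun j _ => ?_
    rw [copiesBasis_repr, copiesBasis_apply]
    simp [lieCopies, Pi.single_eq_of_ne hm.symm]
  · simp

lemma factorial_mul_coeff_mul (f w : PowerSeries ℂ) {k M : ℕ} (hk : k < M) :
    (k.factorial : ℂ) * PowerSeries.coeff k (f * w) =
      ∑ r ∈ Finset.range M, PowerSeries.coeff r f * ((k.descFactorial r : ℂ) *
        (((k - r).factorial : ℂ) * PowerSeries.coeff (k - r) w)) := by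
  rw [PowerSeries.coeff_mul, Finset.Nat.sum_antidiagonal_eq_sum_range_succ_mk, Finset.mul_sum]
  rw [← Finset.sum_subset (Finset.range_subset_range.2 hk : Finset.range (k + 1) ⊆ _)]
  · refine Finset.sum_congr rfl fun r hr => ?_
    rw [Finset.mem_range, Nat.lt_succ_iff] at hr
    rw [← Nat.factorial_mul_descFactorial hr]
    push_cast
    ring
  · intro r _ hr
    rw [Finset.mem_range, not_lt] at hr
    rw [Nat.descFactorial_eq_zero_iff_lt.2 (by omega)]
    simp

/-- Invariants are constant along the quadratic flows of the Lie algebra `𝔰𝔩₂[[t]]`. -/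
lemma arcEval_eq_of_flow {F : ArcRing (Σ _ : Fin n, Fin 3)} (hF : F ∈ currentInvariants n)
    (ξ : Sl2) (f : PowerSeries ℂ) (v v₁ v₂ : (Σ _ : Fin n, Fin 3) → PowerSeries ℂ)
    (h : ∀ (z : ℂ) (m : Fin n) (i : Fin 3), v₁ ⟨m, i⟩ + (2 * z) • v₂ ⟨m, i⟩ =
      f * ∑ j, sl2Coord ⁅ξ, sl2Basis j⁆ i • (v ⟨m, j⟩ + z • v₁ ⟨m, j⟩ + (z ^ 2) • v₂ ⟨m, j⟩)) :
    arcEval (fun p => v p + v₁ p + v₂ p) F = arcEval v F := by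
  rw [currentInvariants, mem_arcInvariants_iff] at hF
  -- `F` involves only levels below `M`, so truncating `f` there turns the action of `ξ f(t)` into a
  -- finite sum of the `ξ t^r`.
  obtain ⟨M, hM⟩ : ∃ M, F ∈ supported ℂ {p : (Σ _ : Fin n, Fin 3) × ℕ | p.2 < M} := by
    refine ⟨F.vars.sup Prod.snd + 1, mem_supported.2 fun p hp => ?_⟩
    exact Nat.lt_succ_of_le (Finset.le_sup (f := Prod.snd) hp)
  -- The minus sign undoes the one in the dual action on coordinates, so that `δ` is the velocity `f
  -- [ξ, v]` of the moving arc.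
  set δ : Derivation ℂ (ArcRing (Σ _ : Fin n, Fin 3)) (ArcRing (Σ _ : Fin n, Fin 3)) :=
    -∑ r ∈ Finset.range M, PowerSeries.coeff r f •
      monomialAction (lieCopies (LieAlgebra.ad ℂ Sl2) n) (copiesBasis n) r ξ with hδ
  have hδ' : ∀ G, δ G = -∑ r ∈ Finset.range M, PowerSeries.coeff r f •
      monomialAction (lieCopies (LieAlgebra.ad ℂ Sl2) n) (copiesBasis n) r ξ G := by
    intro G
    rw [hδ, Derivation.neg_apply, ← Derivation.coeFnAddMonoidHom_apply, map_sum,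
      Finset.sum_apply]
    rfl
  have hδF : δ F = 0 := by
    rw [hδ']
    simp [hF]
  set x : ℂ → (Σ _ : Fin n, Fin 3) × ℕ → ℂ := fun z p =>
    (p.2.factorial : ℂ) * PowerSeries.coeff p.2 (v p.1 + z • v₁ p.1 + (z ^ 2) • v₂ p.1) with hx
  have hder : ∀ z, HasDerivAt (fun w => eval (x w) F) 0 z := by
    intro z
    have := hasDerivAt_eval δ x z (S := {p | p.2 < M}) ?_ hM
    · rwa [hδF, map_zero] at this
    · rintro ⟨⟨m, i⟩, k⟩ hk
      have e1 : eval (x z) (δ (X (⟨m, i⟩, k))) = (k.factorial : ℂ) *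
          PowerSeries.coeff k (v₁ ⟨m, i⟩ + (2 * z) • v₂ ⟨m, i⟩) := by
        rw [h, factorial_mul_coeff_mul _ _ hk, hδ', map_neg, map_sum, ← Finset.sum_neg_distrib]
        refine Finset.sum_congr rfl fun r _ => ?_
        rw [monomialAction_X, dualForm_copies, smul_eval, smul_eval, map_neg, map_sum, mul_neg,
          mul_neg, neg_neg]
        congr 2
        rw [map_sum, Finset.mul_sum]
        refine Finset.sum_congr rfl fun j _ => ?_
        rw [smul_eval, eval_X, map_smul, smul_eq_mul, hx]
        ring
      rw [e1]
      have e2 : (fun w => x w (⟨m, i⟩, k)) = fun w : ℂ => (k.factorial : ℂ) *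
          (PowerSeries.coeff k (v ⟨m, i⟩) + w * PowerSeries.coeff k (v₁ ⟨m, i⟩) +
            w ^ 2 * PowerSeries.coeff k (v₂ ⟨m, i⟩)) := by
        funext w
        simp [hx]
      rw [e2]
      refine HasDerivAt.const_mul _ ?_
      have d1 := (hasDerivAt_id z).mul_const (PowerSeries.coeff k (v₁ ⟨m, i⟩))
      have d2 := (hasDerivAt_pow 2 z).mul_const (PowerSeries.coeff k (v₂ ⟨m, i⟩))
      have d3 := (d1.const_add (PowerSeries.coeff k (v ⟨m, i⟩))).add d2
      exact d3.congr_deriv (by simp)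
  have hconst := is_const_of_deriv_eq_zero (fun z => (hder z).differentiableAt)
    (fun z => (hder z).deriv) 1 0
  rw [arcEval_eq_eval, arcEval_eq_eval]
  simpa [hx] using hconst

/-- The action of the unipotent group of the root vector `x` of `𝔰𝔩₂`. -/
def upperMove (f : PowerSeries ℂ) (v : (Σ _ : Fin n, Fin 3) → PowerSeries ℂ) :
    (Σ _ : Fin n, Fin 3) → PowerSeries ℂ := fun p =>
  ![v ⟨p.1, 0⟩ + f * v ⟨p.1, 2⟩, v ⟨p.1, 1⟩ - 2 * f * v ⟨p.1, 0⟩ - f ^ 2 * v ⟨p.1, 2⟩,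
    v ⟨p.1, 2⟩] p.2

/-- The action of the unipotent group of the root vector `y` of `𝔰𝔩₂`. -/
def lowerMove (f : PowerSeries ℂ) (v : (Σ _ : Fin n, Fin 3) → PowerSeries ℂ) :
    (Σ _ : Fin n, Fin 3) → PowerSeries ℂ := fun p =>
  ![v ⟨p.1, 0⟩ - f * v ⟨p.1, 1⟩, v ⟨p.1, 1⟩,
    v ⟨p.1, 2⟩ + 2 * f * v ⟨p.1, 0⟩ - f ^ 2 * v ⟨p.1, 1⟩] p.2

lemma sl2Coord_lie (A B : Sl2) : sl2Coord ⁅A, B⁆ =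
    ![sl2Coord A 1 * sl2Coord B 2 - sl2Coord A 2 * sl2Coord B 1,
      2 * (sl2Coord A 0 * sl2Coord B 1 - sl2Coord A 1 * sl2Coord B 0),
      2 * (sl2Coord A 2 * sl2Coord B 0 - sl2Coord A 0 * sl2Coord B 2)] := by
  have hA : A.1 1 1 = -A.1 0 0 := by
    have h : A.1 0 0 + A.1 1 1 = 0 := by
      rw [← Matrix.trace_fin_two]
      exact A.2
    linear_combination h
  have hB : B.1 1 1 = -B.1 0 0 := by
    have h : B.1 0 0 + B.1 1 1 = 0 := by
      rw [← Matrix.trace_fin_two]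
      exact B.2
    linear_combination h
  have hl : (⁅A, B⁆ : Sl2).1 = A.1 * B.1 - B.1 * A.1 := rfl
  ext i
  fin_cases i
  · change (⁅A, B⁆ : Sl2).1 0 0 = A.1 0 1 * B.1 1 0 - A.1 1 0 * B.1 0 1
    rw [hl, Matrix.sub_apply, Matrix.mul_apply, Matrix.mul_apply, Fin.sum_univ_two,
      Fin.sum_univ_two]
    ring
  · change (⁅A, B⁆ : Sl2).1 0 1 = 2 * (A.1 0 0 * B.1 0 1 - A.1 0 1 * B.1 0 0)
    rw [hl, Matrix.sub_apply, Matrix.mul_apply, Matrix.mul_apply, Fin.sum_univ_two,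
      Fin.sum_univ_two, hA, hB]
    ring
  · change (⁅A, B⁆ : Sl2).1 1 0 = 2 * (A.1 1 0 * B.1 0 0 - A.1 0 0 * B.1 1 0)
    rw [hl, Matrix.sub_apply, Matrix.mul_apply, Matrix.mul_apply, Fin.sum_univ_two,
      Fin.sum_univ_two, hA, hB]
    ring

lemma arcEval_upperMove {F : ArcRing (Σ _ : Fin n, Fin 3)} (hF : F ∈ currentInvariants n)
    (f : PowerSeries ℂ) (v : (Σ _ : Fin n, Fin 3) → PowerSeries ℂ) :
    arcEval (upperMove f v) F = arcEval v F := by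
  have := arcEval_eq_of_flow hF (sl2Coord.symm ![0, 1, 0]) f v
    -- Since `ad x` is nilpotent of order three, its exponential flow is quadratic in time; these
    -- are the linear and the quadratic term.
    (fun p => ![f * v ⟨p.1, 2⟩, - 2 * f * v ⟨p.1, 0⟩, 0] p.2)
    (fun p => ![0, - f ^ 2 * v ⟨p.1, 2⟩, 0] p.2) (by
      intro z m i
      have h2 : (PowerSeries.C 2 : PowerSeries ℂ) = 2 := map_ofNat _ 2
      simp only [sl2Coord_lie, LinearEquiv.apply_symm_apply, sl2Basis_apply, Fin.sum_univ_three,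
        PowerSeries.smul_eq_C_mul]
      fin_cases i <;> simp [h2] <;> ring)
  rw [← this]
  congr 1
  congr 1
  funext p
  obtain ⟨m, i⟩ := p
  fin_cases i <;> simp [upperMove]; ring

lemma arcEval_lowerMove {F : ArcRing (Σ _ : Fin n, Fin 3)} (hF : F ∈ currentInvariants n)
    (f : PowerSeries ℂ) (v : (Σ _ : Fin n, Fin 3) → PowerSeries ℂ) :
    arcEval (lowerMove f v) F = arcEval v F := by
  have := arcEval_eq_of_flow hF (sl2Coord.symm ![0, 0, 1]) f v
    (fun p => ![-f * v ⟨p.1, 1⟩, 0, 2 * f * v ⟨p.1, 0⟩] p.2)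
    (fun p => ![0, 0, - f ^ 2 * v ⟨p.1, 1⟩] p.2) (by
      intro z m i
      have h2 : (PowerSeries.C 2 : PowerSeries ℂ) = 2 := map_ofNat _ 2
      simp only [sl2Coord_lie, LinearEquiv.apply_symm_apply, sl2Basis_apply, Fin.sum_univ_three,
        PowerSeries.smul_eq_C_mul]
      fin_cases i <;> simp [h2] <;> ring)
  rw [← this]
  congr 1
  congr 1
  funext p
  obtain ⟨m, i⟩ := p
  fin_cases i <;> simp [lowerMove] <;> ring

/-- The action of a representative of the nontrivial element of the Weyl group of `SL₂`. -/
def weylMove (f g : PowerSeries ℂ) (v : (Σ _ : Fin n, Fin 3) → PowerSeries ℂ) :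
    (Σ _ : Fin n, Fin 3) → PowerSeries ℂ := fun p =>
  ![-v ⟨p.1, 0⟩, -(f ^ 2 * v ⟨p.1, 2⟩), -(g ^ 2 * v ⟨p.1, 1⟩)] p.2

lemma arcEval_weylMove {F : ArcRing (Σ _ : Fin n, Fin 3)} (hF : F ∈ currentInvariants n)
    {f g : PowerSeries ℂ} (hfg : f * g = 1) (v : (Σ _ : Fin n, Fin 3) → PowerSeries ℂ) :
    arcEval (weylMove f g v) F = arcEval v F := by
  -- In `SL₂` the Weyl element is a product of three unipotents: upper with `f`, lower with `-f⁻¹`,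
  -- upper with `f`.
  rw [← arcEval_upperMove hF f v, ← arcEval_lowerMove hF (-g) (upperMove f v),
    ← arcEval_upperMove hF f (lowerMove (-g) (upperMove f v))]
  congr 2
  funext p
  obtain ⟨m, i⟩ := p
  fin_cases i
  · simp [weylMove, upperMove, lowerMove]
    linear_combination (-2 * v ⟨m, 0⟩ * (f * g - 1) + g * v ⟨m, 1⟩ -
      f * v ⟨m, 2⟩ * (f * g - 2)) * hfg
  · simp [weylMove, upperMove, lowerMove]
    linear_combination (-v ⟨m, 1⟩ * (f * g - 1) + 2 * f * v ⟨m, 0⟩ * (f * g - 2) +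
      f ^ 2 * v ⟨m, 2⟩ * (f * g - 3)) * hfg
  · simp [weylMove, upperMove, lowerMove]
    linear_combination (-v ⟨m, 2⟩ * (f * g - 1) - 2 * g * v ⟨m, 0⟩) * hfg

end Sl2

/-! ### Classical invariants are invariants of the current algebra -/

section Classical

variable {n : ℕ}

lemma mem_classicalInvariants_iff (f : MvPolynomial (Σ _ : Fin n, Fin 3) ℂ) :
    f ∈ classicalInvariants n ↔ ∀ (g : SU2) (v : Fin n → Sl2),
      eval (fun p => sl2Coord (adjointRep g (v p.1)) p.2) f =
        eval (fun p => sl2Coord (v p.1) p.2) f := by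
  have h1 : ∀ v : Fin n → Sl2, ⇑((copiesBasis n).repr v) = fun p => sl2Coord (v p.1) p.2 := by
    intro v
    funext p
    exact copiesBasis_repr v p.1 p.2
  have h2 : f ∈ classicalInvariants n ↔ ∀ (g : SU2) (v : Fin n → Sl2),
      eval ((copiesBasis n).repr (groupCopies adjointRep n g v)) f =
        eval ((copiesBasis n).repr v) f := Iff.rfl
  rw [h2]
  simp only [h1]
  rfl

/-- The element of `SU(2)` with a given first row. -/
def su2OfRow (a b : ℂ) (h : a * star a + b * star b = 1) : SU2 :=
  ⟨!![a, b; -star b, star a], by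
    rw [Matrix.mem_specialUnitaryGroup_iff, Matrix.mem_unitaryGroup_iff]
    constructor
    · ext i j
      fin_cases i <;> fin_cases j <;>
        simp [Matrix.mul_apply, Fin.sum_univ_two, Matrix.star_apply] <;>
        simp at h <;> first | linear_combination h | ring
    · rw [Matrix.det_fin_two_of]
      linear_combination h⟩

lemma adjointRep_su2OfRow (a b : ℂ) (h : a * star a + b * star b = 1) (A : Sl2) :
    sl2Coord (adjointRep (su2OfRow a b h) A) =
      ![(a * star a - b * star b) * sl2Coord A 0 + a * star b * sl2Coord A 1 +
          star a * b * sl2Coord A 2,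
        -2 * a * b * sl2Coord A 0 + a ^ 2 * sl2Coord A 1 - b ^ 2 * sl2Coord A 2,
        -2 * star a * star b * sl2Coord A 0 - star b ^ 2 * sl2Coord A 1 +
          star a ^ 2 * sl2Coord A 2] := by
  have hA : A.1 1 1 = -A.1 0 0 := by
    have h : A.1 0 0 + A.1 1 1 = 0 := by
      rw [← Matrix.trace_fin_two]
      exact A.2
    linear_combination h
  have hinv : ((su2OfRow a b h)⁻¹).1 = star !![a, b; -star b, star a] := rfl
  have hval : (adjointRep (su2OfRow a b h) A).1 =
      !![a, b; -star b, star a] * A.1 * star !![a, b; -star b, star a] := by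
    rw [← hinv]
    rfl
  have key : ∀ i j, (adjointRep (su2OfRow a b h) A).1 i j =
      (!![a, b; -star b, star a] * A.1 * star !![a, b; -star b, star a]) i j := by
    intro i j
    rw [hval]
  ext i
  fin_cases i
  · refine (key 0 0).trans ?_
    simp only [Matrix.mul_apply, Fin.sum_univ_two, Matrix.star_apply, hA]
    simp [sl2Coord]
    ring
  · refine (key 0 1).trans ?_
    simp only [Matrix.mul_apply, Fin.sum_univ_two, Matrix.star_apply, hA]
    simp [sl2Coord]
    ring
  · refine (key 1 0).trans ?_
    simp only [Matrix.mul_apply, Fin.sum_univ_two, Matrix.star_apply, hA]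
    simp [sl2Coord]
    ring

lemma toArc_mem_supported {ι : Type*} (f : MvPolynomial ι ℂ) :
    toArc ι f ∈ supported ℂ {p : ι × ℕ | p.2 = 0} := by
  induction f using MvPolynomial.induction_on with
  | C a =>
    rw [MvPolynomial.algHom_C]
    exact Subalgebra.algebraMap_mem _ _
  | add p q hp hq =>
    rw [map_add]
    exact Subalgebra.add_mem _ hp hq
  | mul_X p i hp =>
    rw [map_mul]
    refine Subalgebra.mul_mem _ hp ?_
    rw [toArc, rename_X]
    exact Algebra.subset_adjoin ⟨(i, 0), rfl, rfl⟩

/-- The matrix `η` with first row `(i p, q)` lies in `𝔰𝔲(2)` and satisfies `η² = -1`, so its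
one-parameter group is `cos θ + η sin θ`. The invariant `f` is constant along this curve, and its
derivative at `θ = 0` is the action of `η` up to sign. -/
lemma monomialAction_toArc_of_row {f : MvPolynomial (Σ _ : Fin n, Fin 3) ℂ}
    (hf : f ∈ classicalInvariants n) (p : ℝ) (q : ℂ) (hpq : (p : ℂ) ^ 2 + q * star q = 1) :
    monomialAction (lieCopies (LieAlgebra.ad ℂ Sl2) n) (copiesBasis n) 0
      (sl2Coord.symm ![Complex.I * p, q, -star q]) (toArc _ f) = 0 := by
  rw [mem_classicalInvariants_iff] at hf
  set η : Sl2 := sl2Coord.symm ![Complex.I * p, q, -star q] with hη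
  set a : ℝ → ℂ := fun θ => Real.cos θ + Complex.I * p * Real.sin θ with ha
  set b : ℝ → ℂ := fun θ => q * Real.sin θ with hb
  have hrow : ∀ θ, a θ * star (a θ) + b θ * star (b θ) = 1 := by
    intro θ
    have h1 : ((Real.cos θ : ℝ) : ℂ) ^ 2 + ((Real.sin θ : ℝ) : ℂ) ^ 2 = 1 := by
      rw [← Complex.ofReal_pow, ← Complex.ofReal_pow, ← Complex.ofReal_add,
        Real.cos_sq_add_sin_sq, Complex.ofReal_one]
    simp only [ha, hb, star_add, star_mul', Complex.star_def, Complex.conj_ofReal, Complex.conj_I]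
      at hpq ⊢
    linear_combination h1 + ((Real.sin θ : ℝ) : ℂ) ^ 2 * hpq -
      (p : ℂ) ^ 2 * ((Real.sin θ : ℝ) : ℂ) ^ 2 * Complex.I_sq
  have hcos : HasDerivAt (fun θ : ℝ => ((Real.cos θ : ℝ) : ℂ)) 0 0 := by
    have := (Real.hasDerivAt_cos 0).ofReal_comp
    simpa using this
  have hsin : HasDerivAt (fun θ : ℝ => ((Real.sin θ : ℝ) : ℂ)) 1 0 := by
    have := (Real.hasDerivAt_sin 0).ofReal_comp
    simpa using this
  have hda : HasDerivAt a (Complex.I * p) 0 := by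
    exact (hcos.add (hsin.const_mul (Complex.I * p))).congr_deriv (by simp)
  have hdb : HasDerivAt b q 0 := by
    exact (hsin.const_mul q).congr_deriv (by simp)
  have hda' : HasDerivAt (fun θ => star (a θ)) (-(Complex.I * p)) 0 := by
    have := hcos.add (hsin.const_mul (-(Complex.I * p)))
    have he : (fun θ => star (a θ)) = fun θ : ℝ => ((Real.cos θ : ℝ) : ℂ) +
        -(Complex.I * p) * ((Real.sin θ : ℝ) : ℂ) := by
      funext θ
      simp [ha, -Complex.ofReal_cos, -Complex.ofReal_sin]
    rw [he]
    exact this.congr_deriv (by simp)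
  have hdb' : HasDerivAt (fun θ => star (b θ)) (star q) 0 := by
    have := hsin.const_mul (star q)
    have he : (fun θ => star (b θ)) = fun θ : ℝ => star q * ((Real.sin θ : ℝ) : ℂ) := by
      funext θ
      simp [hb, -Complex.ofReal_cos, -Complex.ofReal_sin]
    rw [he]
    exact this.congr_deriv (by simp)
  have ha0 : a 0 = 1 := by simp [ha]
  have hb0 : b 0 = 0 := by simp [hb]
  apply MvPolynomial.funext
  intro y
  rw [map_zero]
  set v : Fin n → Sl2 := fun m => sl2Coord.symm fun i => y (⟨m, i⟩, 0) with hv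
  -- Only the level-zero coordinates move, since `toArc _ f` involves no others.
  set x : ℝ → (Σ _ : Fin n, Fin 3) × ℕ → ℂ := fun θ s =>
    if s.2 = 0 then
      sl2Coord (adjointRep (su2OfRow (a θ) (b θ) (hrow θ)) (v s.1.1)) s.1.2 else y s with hx
  have hx0 : x 0 = y := by
    funext s
    obtain ⟨⟨m, i⟩, k⟩ := s
    simp only [hx, adjointRep_su2OfRow, ha0, hb0]
    split_ifs with hk
    · change k = 0 at hk
      subst hk
      fin_cases i <;> simp [hv]
    · rfl
  have hder := hasDerivAt_eval
    (-monomialAction (lieCopies (LieAlgebra.ad ℂ Sl2) n) (copiesBasis n) 0 η) x 0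
    (S := {p | p.2 = 0}) ?_ (toArc_mem_supported f)
  · have hconst : (fun θ => eval (x θ) (toArc _ f)) = fun _ => eval (x 0) (toArc _ f) := by
      have hev : ∀ θ, eval (x θ) (toArc _ f) = eval (fun p => sl2Coord (v p.1) p.2) f := by
        intro θ
        rw [← hf (su2OfRow (a θ) (b θ) (hrow θ)) v, toArc]
        simp only [eval_rename]
        rfl
      funext θ
      rw [hev, hev]
    rw [hconst] at hder
    have := hder.unique (hasDerivAt_const _ _)
    rw [hx0] at this
    simpa using this
  · rintro ⟨⟨m, i⟩, k⟩ hk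
    change k = 0 at hk
    subst hk
    have hRHS : eval (x 0) ((-monomialAction (lieCopies (LieAlgebra.ad ℂ Sl2) n)
        (copiesBasis n) 0 η) (X (⟨m, i⟩, 0))) = sl2Coord ⁅η, v m⁆ i := by
      rw [hx0, Derivation.neg_apply, monomialAction_X, dualForm_copies]
      simp only [sl2Coord_lie, sl2Basis_apply, LinearEquiv.apply_symm_apply, hv,
        Fin.sum_univ_three, hη]
      fin_cases i <;> simp [smul_eval] <;> ring
    rw [hRHS]
    have hfun : (fun θ => x θ (⟨m, i⟩, 0)) = fun θ =>
        sl2Coord (adjointRep (su2OfRow (a θ) (b θ) (hrow θ)) (v m)) i := by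
      funext θ
      simp [hx]
    rw [hfun]
    simp only [adjointRep_su2OfRow, sl2Coord_lie, hη, LinearEquiv.apply_symm_apply]
    fin_cases i
    · have := (((hda.mul hda').sub (hdb.mul hdb')).mul_const (sl2Coord (v m) 0)).add
        ((hda.mul hdb').mul_const (sl2Coord (v m) 1)) |>.add
        ((hda'.mul hdb).mul_const (sl2Coord (v m) 2))
      refine this.congr_deriv ?_
      simp [ha0, hb0]
      ring
    · have := ((((hda.const_mul (-2)).mul hdb).mul_const (sl2Coord (v m) 0)).add
        ((hda.pow 2).mul_const (sl2Coord (v m) 1))).sub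
        ((hdb.pow 2).mul_const (sl2Coord (v m) 2))
      refine this.congr_deriv ?_
      simp [ha0, hb0]
      ring
    · have := ((((hda'.const_mul (-2)).mul hdb').mul_const (sl2Coord (v m) 0)).sub
        ((hdb'.pow 2).mul_const (sl2Coord (v m) 1))).add
        ((hda'.pow 2).mul_const (sl2Coord (v m) 2))
      refine this.congr_deriv ?_
      simp [ha0, hb0]
      ring

/-- Three unit elements of `𝔰𝔲(2)` span `𝔰𝔩₂` over `ℂ`, and the action is complex linear in `ξ`. -/
lemma monomialAction_zero_toArc {f : MvPolynomial (Σ _ : Fin n, Fin 3) ℂ}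
    (hf : f ∈ classicalInvariants n) (ξ : Sl2) :
    monomialAction (lieCopies (LieAlgebra.ad ℂ Sl2) n) (copiesBasis n) 0 ξ (toArc _ f) = 0 := by
  have h1 := monomialAction_toArc_of_row hf 1 0 (by simp)
  have h2 := monomialAction_toArc_of_row hf 0 1 (by simp)
  have h3 := monomialAction_toArc_of_row hf 0 Complex.I (by simp)
  have hξ : ξ = (-Complex.I * sl2Coord ξ 0) •
        sl2Coord.symm ![Complex.I * ((1 : ℝ) : ℂ), 0, -star 0] +
      ((sl2Coord ξ 1 - sl2Coord ξ 2) / 2) •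
        sl2Coord.symm ![Complex.I * ((0 : ℝ) : ℂ), 1, -star 1] +
      (-Complex.I * (sl2Coord ξ 1 + sl2Coord ξ 2) / 2) •
        sl2Coord.symm ![Complex.I * ((0 : ℝ) : ℂ), Complex.I, -star Complex.I] := by
    apply sl2Coord.injective
    simp only [map_add, map_smul, LinearEquiv.apply_symm_apply]
    ext i
    fin_cases i
    · simp
      linear_combination (sl2Coord ξ 0) * Complex.I_sq
    · simp
      linear_combination ((sl2Coord ξ 1 + sl2Coord ξ 2) / 2) * Complex.I_sq
    · simp
      linear_combination ((sl2Coord ξ 1 + sl2Coord ξ 2) / 2) * Complex.I_sq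
  rw [hξ]
  simp only [map_add, map_smul, Derivation.add_apply, Derivation.smul_apply, h1, h2, h3,
    smul_zero, add_zero]

end Classical

/-! ### Stability of the current invariants under `D` -/

section General

attribute [local instance 100] LieRing.ofAssociativeRing

variable {ι V L : Type*} [Fintype ι] [AddCommGroup V] [Module ℂ V] [LieRing L] [LieAlgebra ℂ L]

lemma arcD_dualForm (ρ : L →ₗ⁅ℂ⁆ Module.End ℂ V) (b : Module.Basis ι ℂ V) (ξ : L) (i : ι)
    (k : ℕ) : arcD ι (dualForm ρ b ξ i k) = dualForm ρ b ξ i (k + 1) := by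
  simp [dualForm, arcD, mkDerivation_X]

/-- The commutator of `ξ t^r` with `D` is `r ξ t^(r-1)`, as for differentiation in `t`. At `r = 0`
the truncated `r - 1` is harmless because its coefficient is zero. Hence `D` preserves the elements
killed by all of `𝔤[t]`. -/
lemma monomialAction_arcD (ρ : L →ₗ⁅ℂ⁆ Module.End ℂ V) (b : Module.Basis ι ℂ V) (r : ℕ) (ξ : L)
    (F : ArcRing ι) : monomialAction ρ b r ξ (arcD ι F) =
      arcD ι (monomialAction ρ b r ξ F) + (r : ℂ) • monomialAction ρ b (r - 1) ξ F := by
  have key : ⁅monomialAction ρ b r ξ, arcD ι⁆ = (r : ℂ) • monomialAction ρ b (r - 1) ξ := by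
    apply MvPolynomial.derivation_ext
    rintro ⟨i, k⟩
    have hX : arcD ι (X (i, k)) = X (i, k + 1) := by simp [arcD, mkDerivation_X]
    rw [Derivation.commutator_apply, Derivation.smul_apply, hX, monomialAction_X,
      monomialAction_X, monomialAction_X, Derivation.map_smul, arcD_dualForm]
    rcases r with _ | r
    · simp
    · rcases Nat.lt_or_ge k r with hk | hk
      · rw [Nat.descFactorial_of_lt (by omega : k + 1 < r + 1),
          Nat.descFactorial_of_lt (by omega : k < r + 1),
          Nat.descFactorial_of_lt (by omega : k < r + 1 - 1)]
        simp
      · rw [Nat.succ_descFactorial_succ, Nat.descFactorial_succ, Nat.add_sub_add_right,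
          Nat.add_sub_cancel]
        rcases Nat.eq_or_lt_of_le hk with rfl | hlt
        · simp [smul_smul]
        · rw [show k - (r + 1) + 1 = k - r by omega, ← sub_smul, smul_smul]
          congr 1
          rw [Nat.cast_mul, Nat.cast_mul, Nat.cast_sub hk]
          push_cast
          ring
  have h := congrArg (fun δ : Derivation ℂ (ArcRing ι) (ArcRing ι) => δ F) key
  simp only [Derivation.commutator_apply, Derivation.smul_apply] at h
  rw [← h]
  ring

lemma monomialAction_toArc_of_pos (ρ : L →ₗ⁅ℂ⁆ Module.End ℂ V) (b : Module.Basis ι ℂ V) {r : ℕ}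
    (hr : r ≠ 0) (ξ : L) (f : MvPolynomial ι ℂ) : monomialAction ρ b r ξ (toArc ι f) = 0 := by
  have : monomialAction ρ b r ξ (toArc ι f) =
      (0 : Derivation ℂ (ArcRing ι) (ArcRing ι)) (toArc ι f) := by
    refine derivation_eqOn_supported ?_ (toArc_mem_supported f)
    rintro ⟨i, k⟩ hk
    change k = 0 at hk
    subst hk
    simp [monomialAction_X, Nat.descFactorial_of_lt (Nat.pos_of_ne_zero hr)]
  simpa using this

lemma iterate_arcD_mem_arcInvariants (ρ : L →ₗ⁅ℂ⁆ Module.End ℂ V) (b : Module.Basis ι ℂ V)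
    {F : ArcRing ι} (hF : F ∈ arcInvariants ρ b) (k : ℕ) :
    (arcD ι)^[k] F ∈ arcInvariants ρ b := by
  induction k with
  | zero => exact hF
  | succ k ih =>
    rw [Function.iterate_succ_apply', mem_arcInvariants_iff]
    rw [mem_arcInvariants_iff] at ih
    intro r ξ
    rw [monomialAction_arcD, ih, ih, map_zero, smul_zero, add_zero]

end General

theorem differentialSpan_le_currentInvariants (n : ℕ) :
    differentialSpan (classicalInvariants n) ≤ currentInvariants n := by
  rw [differentialSpan, Algebra.adjoin_le_iff]
  rintro F ⟨f, hf, k, rfl⟩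
  refine iterate_arcD_mem_arcInvariants _ _ ?_ k
  rw [mem_arcInvariants_iff]
  intro r ξ
  by_cases hr : r = 0
  · subst hr
    exact monomialAction_zero_toArc hf ξ
  · exact monomialAction_toArc_of_pos _ _ hr ξ f

/-! ### The generators of the classical invariants of three copies -/

/-- The quadratic form `-det` on a copy of `𝔰𝔩₂`. -/
def copyQuad (m : Fin 3) : MvPolynomial (Σ _ : Fin 3, Fin 3) ℂ :=
  X ⟨m, 0⟩ * X ⟨m, 0⟩ + X ⟨m, 1⟩ * X ⟨m, 2⟩

/-- The polar form of `-det` at a pair of copies of `𝔰𝔩₂`. -/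
def copyPolar (m l : Fin 3) : MvPolynomial (Σ _ : Fin 3, Fin 3) ℂ :=
  (2 : ℂ) • (X ⟨m, 0⟩ * X ⟨l, 0⟩) + X ⟨m, 1⟩ * X ⟨l, 2⟩ + X ⟨m, 2⟩ * X ⟨l, 1⟩

/-- The determinant of the coordinates of three elements of `𝔰𝔩₂`. -/
def copyDet : MvPolynomial (Σ _ : Fin 3, Fin 3) ℂ :=
  X ⟨0, 0⟩ * (X ⟨1, 1⟩ * X ⟨2, 2⟩ - X ⟨1, 2⟩ * X ⟨2, 1⟩) -
    X ⟨0, 1⟩ * (X ⟨1, 0⟩ * X ⟨2, 2⟩ - X ⟨1, 2⟩ * X ⟨2, 0⟩) +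
    X ⟨0, 2⟩ * (X ⟨1, 0⟩ * X ⟨2, 1⟩ - X ⟨1, 1⟩ * X ⟨2, 0⟩)

/-- The entries of the Gram matrix and the determinant, as functions on three copies of `𝔰𝔩₂`. -/
def gramMap : Fin 7 → MvPolynomial (Σ _ : Fin 3, Fin 3) ℂ :=
  ![copyQuad 0, copyQuad 1, copyQuad 2, copyPolar 1 2, copyPolar 0 2, copyPolar 0 1, copyDet]

lemma aeval_gramMap_gramRelation : aeval gramMap gramRelation = 0 := by
  have h2 : (C 2 : MvPolynomial (Σ _ : Fin 3, Fin 3) ℂ) = 2 := map_ofNat _ 2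
  have h4 : (C 4 : MvPolynomial (Σ _ : Fin 3, Fin 3) ℂ) = 4 := map_ofNat _ 4
  simp only [gramRelation, map_add, map_sub, map_mul, aeval_X, gramMap, copyQuad,
    copyPolar, copyDet, smul_eq_C_mul, h2]
  simp [h4]
  ring

lemma sl2_apply_one_one (A : Sl2) : A.1 1 1 = -A.1 0 0 := by
  have h : A.1 0 0 + A.1 1 1 = 0 := by
    rw [← Matrix.trace_fin_two]
    exact A.2
  linear_combination h

lemma trace_mul_eq (A B : Sl2) : (A.1 * B.1).trace =
    2 * (sl2Coord A 0 * sl2Coord B 0) + sl2Coord A 1 * sl2Coord B 2 +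
      sl2Coord A 2 * sl2Coord B 1 := by
  simp only [Matrix.trace_fin_two, Matrix.mul_apply, Fin.sum_univ_two, sl2_apply_one_one]
  simp [sl2Coord]
  ring

lemma trace_mul_mul_sub_eq (A B D : Sl2) :
    (A.1 * B.1 * D.1).trace - (B.1 * A.1 * D.1).trace =
    2 * (sl2Coord A 0 * (sl2Coord B 1 * sl2Coord D 2 - sl2Coord B 2 * sl2Coord D 1) -
      sl2Coord A 1 * (sl2Coord B 0 * sl2Coord D 2 - sl2Coord B 2 * sl2Coord D 0) +
      sl2Coord A 2 * (sl2Coord B 0 * sl2Coord D 1 - sl2Coord B 1 * sl2Coord D 0)) := by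
  simp only [Matrix.trace_fin_two, Matrix.mul_apply, Fin.sum_univ_two, sl2_apply_one_one]
  simp [sl2Coord]
  ring

lemma adjointRep_mul (g : SU2) (A B : Matrix (Fin 2) (Fin 2) ℂ) :
    (g.1 * A * (g⁻¹).1) * (g.1 * B * (g⁻¹).1) = g.1 * (A * B) * (g⁻¹).1 := by
  have h : (g⁻¹).1 * g.1 = 1 := congrArg Subtype.val (inv_mul_cancel g)
  calc _ = g.1 * A * ((g⁻¹).1 * g.1) * B * (g⁻¹).1 := by simp only [mul_assoc]
    _ = _ := by rw [h]; simp only [mul_assoc, one_mul]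

lemma trace_conj (g : SU2) (A : Matrix (Fin 2) (Fin 2) ℂ) :
    (g.1 * A * (g⁻¹).1).trace = A.trace := by
  have h : (g⁻¹).1 * g.1 = 1 := congrArg Subtype.val (inv_mul_cancel g)
  rw [Matrix.trace_mul_comm, ← mul_assoc, h, one_mul]

/-- The polar form of `-det` on `𝔰𝔩₂` is the trace form `tr(AB)`, which conjugation preserves. -/
lemma copyPolar_mem (m m' : Fin 3) : copyPolar m m' ∈ classicalInvariants 3 := by
  rw [mem_classicalInvariants_iff]
  intro g v
  have key : ∀ u : Fin 3 → Sl2, eval (fun p => sl2Coord (u p.1) p.2) (copyPolar m m') =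
      ((u m).1 * (u m').1).trace := by
    intro u
    rw [trace_mul_eq]
    simp [copyPolar, smul_eval]
  rw [key, key fun m => adjointRep g (v m), ← trace_conj g ((v m).1 * (v m').1), ← adjointRep_mul]
  rfl

lemma copyQuad_mem (m : Fin 3) : copyQuad m ∈ classicalInvariants 3 := by
  have h : copyQuad m = (2 : ℂ)⁻¹ • copyPolar m m := by
    rw [copyQuad, copyPolar, mul_comm (X ⟨m, 2⟩ : MvPolynomial (Σ _ : Fin 3, Fin 3) ℂ)]
    module
  rw [h]
  exact Subalgebra.smul_mem _ (copyPolar_mem m m) _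

lemma copyDet_mem : copyDet ∈ classicalInvariants 3 := by
  rw [mem_classicalInvariants_iff]
  intro g v
  -- The determinant is half of `tr([A, B] D)`, hence a combination of conjugation-invariant traces.
  have key : ∀ u : Fin 3 → Sl2, 2 * eval (fun p => sl2Coord (u p.1) p.2) copyDet =
      ((u 0).1 * (u 1).1 * (u 2).1).trace - ((u 1).1 * (u 0).1 * (u 2).1).trace := by
    intro u
    rw [trace_mul_mul_sub_eq]
    simp [copyDet]
  refine mul_left_cancel₀ (two_ne_zero (α := ℂ)) ?_
  rw [key, key fun m => adjointRep g (v m)]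
  have h : ∀ A B D : Sl2, ((adjointRep g A).1 * (adjointRep g B).1 * (adjointRep g D).1).trace =
      (A.1 * B.1 * D.1).trace := by
    intro A B D
    rw [← trace_conj g (A.1 * B.1 * D.1), ← adjointRep_mul, ← adjointRep_mul]
    rfl
  rw [h, h]

lemma gramMap_mem (j : Fin 7) : gramMap j ∈ classicalInvariants 3 := by
  fin_cases j
  exacts [copyQuad_mem 0, copyQuad_mem 1, copyQuad_mem 2, copyPolar_mem 1 2, copyPolar_mem 0 2,
    copyPolar_mem 0 1, copyDet_mem]

lemma arcMap_gramMap_mem (F : ArcRing (Fin 7)) :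
    arcMap gramMap F ∈ differentialSpan (classicalInvariants 3) := by
  induction F using MvPolynomial.induction_on with
  | C a =>
    rw [MvPolynomial.algHom_C]
    exact Subalgebra.algebraMap_mem _ _
  | add p q hp hq =>
    rw [map_add]
    exact Subalgebra.add_mem _ hp hq
  | mul_X p x hp =>
    rw [map_mul]
    refine Subalgebra.mul_mem _ hp ?_
    obtain ⟨j, k⟩ := x
    rw [arcMap_X]
    exact Algebra.subset_adjoin ⟨gramMap j, gramMap_mem j, k, rfl⟩

/-! ### Saturation and division of power series -/

section Saturation

variable {R : Type*} [CommRing R] [Algebra ℂ R]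

/-- The elements which a power of `e` multiplies into a subalgebra. -/
def saturation (B : Subalgebra ℂ R) {e : R} (he : e ∈ B) : Subalgebra ℂ R where
  carrier := {g | ∃ N : ℕ, e ^ N * g ∈ B}
  mul_mem' := by
    rintro a b ⟨N, ha⟩ ⟨M, hb⟩
    refine ⟨N + M, ?_⟩
    rw [pow_add, mul_mul_mul_comm]
    exact B.mul_mem ha hb
  add_mem' := by
    rintro a b ⟨N, ha⟩ ⟨M, hb⟩
    refine ⟨N + M, ?_⟩
    have : e ^ (N + M) * (a + b) = e ^ M * (e ^ N * a) + e ^ N * (e ^ M * b) := by ring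
    rw [this]
    exact B.add_mem (B.mul_mem (B.pow_mem he M) ha) (B.mul_mem (B.pow_mem he N) hb)
  algebraMap_mem' := fun c => ⟨0, by
    rw [pow_zero, one_mul]
    exact B.algebraMap_mem c⟩

lemma le_saturation (B : Subalgebra ℂ R) {e : R} (he : e ∈ B) : B ≤ saturation B he := by
  intro b hb
  exact ⟨0, by rwa [pow_zero, one_mul]⟩

lemma mem_saturation_of_mul_mem {B : Subalgebra ℂ R} {e : R} (he : e ∈ B) {g : R}
    (h : e * g ∈ saturation B he) : g ∈ saturation B he := by
  obtain ⟨N, hN⟩ := h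
  exact ⟨N + 1, by rwa [pow_succ, mul_assoc]⟩

/-- The power series with coefficients in a subalgebra. -/
def coeffSubalgebra (A : Subalgebra ℂ R) : Subalgebra ℂ (PowerSeries R) where
  carrier := {f | ∀ k, PowerSeries.coeff k f ∈ A}
  mul_mem' := by
    intro f g hf hg k
    rw [PowerSeries.coeff_mul]
    exact A.sum_mem fun p _ => A.mul_mem (hf _) (hg _)
  add_mem' := by
    intro f g hf hg k
    rw [map_add]
    exact A.add_mem (hf k) (hg k)
  algebraMap_mem' := by
    intro c k
    rw [PowerSeries.algebraMap_apply, PowerSeries.coeff_C]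
    split_ifs
    · exact A.algebraMap_mem c
    · exact A.zero_mem

/-- Long division: the coefficient of `t^k` in `x * y` is `x₀ y_k` plus terms with earlier
coefficients of `y`. Only the division by `x₀` leaves the ring operations, and `hc` permits it. -/
lemma mem_coeffSubalgebra_of_mul {A : Subalgebra ℂ R} {x y : PowerSeries R}
    (hx : x ∈ coeffSubalgebra A) (hxy : x * y ∈ coeffSubalgebra A)
    (hc : ∀ r, PowerSeries.coeff 0 x * r ∈ A → r ∈ A) : y ∈ coeffSubalgebra A := by
  intro k
  induction k using Nat.strong_induction_on with
  | _ k ih =>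
    apply hc
    have h := hxy k
    rw [PowerSeries.coeff_mul, Finset.Nat.sum_antidiagonal_eq_sum_range_succ_mk,
      Finset.sum_range_succ', Nat.sub_zero] at h
    refine (add_mem_cancel_left (A.sum_mem fun i hi => A.mul_mem (hx _) (ih _ ?_))).1 h
    rw [Finset.mem_range] at hi
    omega

lemma coeff_succ_mul_self {S : Type*} [CommRing S] (x : PowerSeries S) (n : ℕ) :
    PowerSeries.coeff (n + 1) (x * x) =
    2 * (PowerSeries.coeff 0 x * PowerSeries.coeff (n + 1) x) + ∑ i ∈ Finset.range n,
      PowerSeries.coeff (i + 1) x * PowerSeries.coeff (n - i) x := by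
  rw [PowerSeries.coeff_mul, Finset.Nat.sum_antidiagonal_eq_sum_range_succ_mk,
    Finset.sum_range_succ', Finset.sum_range_succ]
  simp only [Nat.sub_zero, Nat.add_sub_add_right, Nat.sub_self]
  ring

/-- The same recursion for a square root: beyond its constant term, each coefficient is found by
dividing by `2 x₀`. -/
lemma mem_coeffSubalgebra_of_mul_self {A : Subalgebra ℂ R} {x : PowerSeries R}
    (hx : PowerSeries.coeff 0 x ∈ A) (hxx : x * x ∈ coeffSubalgebra A)
    (hc : ∀ r, PowerSeries.coeff 0 x * r ∈ A → r ∈ A) : x ∈ coeffSubalgebra A := by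
  intro k
  induction k using Nat.strong_induction_on with
  | _ k ih =>
    rcases k with _ | n
    · exact hx
    · apply hc
      have h := hxx (n + 1)
      rw [coeff_succ_mul_self] at h
      have h2 := (add_mem_cancel_right (A.sum_mem fun i hi => by
        rw [Finset.mem_range] at hi
        exact A.mul_mem (ih (i + 1) (by omega)) (ih (n - i) (by omega)))).1 h
      have h3 := A.smul_mem h2 ((2 : ℂ)⁻¹)
      have h4 : (2 : ℂ)⁻¹ • (2 * (PowerSeries.coeff 0 x * PowerSeries.coeff (n + 1) x)) =
          PowerSeries.coeff 0 x * PowerSeries.coeff (n + 1) x := by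
        rw [two_mul, ← two_smul ℂ, smul_smul, inv_mul_cancel₀ two_ne_zero, one_smul]
      rwa [h4] at h3

end Saturation

/-! ### Square roots of power series with nonzero constant term -/

section SquareRoot

/-- The coefficients of a square root of a power series. -/
def sqrtCoeff (f : PowerSeries ℂ) (c : ℂ) : ℕ → ℂ
  | 0 => c
  | n + 1 => (PowerSeries.coeff (n + 1) f -
      ∑ i : Fin n, sqrtCoeff f c (i + 1) * sqrtCoeff f c (n - i)) / (2 * c)

lemma exists_mul_self_eq {f : PowerSeries ℂ} (hf : PowerSeries.constantCoeff f ≠ 0) :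
    ∃ r : PowerSeries ℂ, r * r = f := by
  obtain ⟨c, hc⟩ := IsAlgClosed.exists_pow_nat_eq (PowerSeries.constantCoeff f) two_pos
  have hc0 : c ≠ 0 := by
    rintro rfl
    exact hf (by rw [← hc]; simp)
  refine ⟨PowerSeries.mk (sqrtCoeff f c), ?_⟩
  ext k
  rcases k with _ | n
  · rw [PowerSeries.coeff_zero_eq_constantCoeff_apply, map_mul,
      ← PowerSeries.coeff_zero_eq_constantCoeff_apply, PowerSeries.coeff_mk, sqrtCoeff, ← sq, hc,
      PowerSeries.coeff_zero_eq_constantCoeff_apply]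
  · rw [coeff_succ_mul_self]
    simp only [PowerSeries.coeff_mk]
    rw [sqrtCoeff, sqrtCoeff,
      Finset.sum_range fun i => sqrtCoeff f c (i + 1) * sqrtCoeff f c (n - i)]
    field_simp
    ring

end SquareRoot

/-! ### Restriction of invariants to a slice -/

/-- The slice of the triples `(s h, u h + x + w y, p h + m x + n y)` in three copies of `𝔰𝔩₂`. -/
def sliceMap (p : Σ _ : Fin 3, Fin 3) : MvPolynomial (Fin 6) ℂ :=
  ![![X 0, 0, 0], ![X 1, 1, X 2], ![X 3, X 4, X 5]] p.1 p.2

/-- The restrictions of the functions of the Gram matrix and the determinant to the slice. -/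
def gramSliceMap : ArcRing (Fin 7) →ₐ[ℂ] ArcRing (Fin 6) :=
  arcMap fun j => aeval sliceMap (gramMap j)

lemma arcMap_sliceMap_gramMap (F : ArcRing (Fin 7)) :
    arcMap sliceMap (arcMap gramMap F) = gramSliceMap F :=
  arcMap_arcMap _ _ F

/-- The algebra generated by the restrictions of the functions of the Gram matrix and the
determinant to the slice, together with the coordinate `s`. -/
def gramSliceAlgebra : Subalgebra ℂ (ArcRing (Fin 6)) where
  carrier := {g | ∃ h₀ h₁, g = gramSliceMap h₀ + X (0, 0) * gramSliceMap h₁}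
  mul_mem' := by
    rintro _ _ ⟨a, b, rfl⟩ ⟨c, d, rfl⟩
    refine ⟨a * c + X (0, 0) * (b * d), a * d + b * c, ?_⟩
    have h : gramSliceMap (X (0, 0)) = X (0, 0) * X (0, 0) := by
      rw [gramSliceMap, arcMap_X]
      simp [gramMap, copyQuad, sliceMap, toArc]
    simp only [map_add, map_mul, h]
    ring
  add_mem' := by
    rintro _ _ ⟨a, b, rfl⟩ ⟨c, d, rfl⟩
    refine ⟨a + c, b + d, ?_⟩
    simp only [map_add]
    ring
  algebraMap_mem' := fun c => ⟨algebraMap ℂ _ c, 0, by simp⟩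

lemma gramSliceMap_mem (F : ArcRing (Fin 7)) : gramSliceMap F ∈ gramSliceAlgebra :=
  ⟨F, 0, by simp⟩

/-- On the slice the minor is `4 s⁴ w` at level zero, so inverting it allows division by the
constant terms of `s` and `w`, the two denominators that arise in solving for the coordinates. -/
lemma gramSliceMap_gramMinor : gramSliceMap (toArc (Fin 7) (gramMinor 0 1 5)) =
    (4 : ℂ) • (X (0, 0) ^ 4 * X (2, 0)) := by
  rw [gramSliceMap, arcMap_toArc]
  have h2 : (C 2 : ArcRing (Fin 6)) = 2 := map_ofNat _ 2
  have h4 : (C 4 : ArcRing (Fin 6)) = 4 := map_ofNat _ 4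
  simp [gramMinor, gramMap, copyQuad, copyPolar, sliceMap, toArc, smul_eq_C_mul, h2, h4]
  ring

lemma aeval_genericArc_gramMap_mem {A : Subalgebra ℂ (ArcRing (Fin 6))} (hA : gramSliceAlgebra ≤ A)
    (j : Fin 7) : aeval (genericArc (Fin 6)) (aeval sliceMap (gramMap j)) ∈ coeffSubalgebra A := by
  intro k
  rw [coeff_aeval_genericArc, ← smul_eq_C_mul]
  refine A.smul_mem (hA ?_) _
  have := gramSliceMap_mem (X (j, k))
  rwa [gramSliceMap, arcMap_X] at this

/-- On the open set where the minor does not vanish, all coordinates of the slice are functions of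
`s`, the Gram matrix and the determinant. -/
lemma saturation_gramSliceAlgebra_eq_top :
    saturation gramSliceAlgebra (gramSliceMap_mem (toArc (Fin 7) (gramMinor 0 1 5))) = ⊤ := by
  set e := gramSliceMap (toArc (Fin 7) (gramMinor 0 1 5)) with he
  set A := saturation gramSliceAlgebra (gramSliceMap_mem (toArc (Fin 7) (gramMinor 0 1 5))) with hA
  have hle : gramSliceAlgebra ≤ A := le_saturation _ _
  have he' : e = X (0, 0) * ((4 : ℂ) • (X (0, 0) ^ 3 * X (2, 0))) := by
    rw [he, gramSliceMap_gramMinor]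
    simp only [smul_eq_C_mul]
    ring
  have hdiv : ∀ r, e * r ∈ A → r ∈ A := fun r hr => mem_saturation_of_mul_mem _ hr
  -- Only the constant term of `s` has to be adjoined: the Gram data contain `s²`, which determines
  -- the higher coefficients by division.
  have h00 : (X (0, 0) : ArcRing (Fin 6)) ∈ A := hle ⟨0, 1, by simp⟩
  have hx0 : PowerSeries.coeff 0 (genericArc (Fin 6) 0) = X (0, 0) := by
    simp [genericArc]
  have hx2 : PowerSeries.coeff 0 (genericArc (Fin 6) 2) = X (2, 0) := by
    simp [genericArc]
  have hg := aeval_genericArc_gramMap_mem hle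
  set x := genericArc (Fin 6) with hx
  have half : ∀ y : PowerSeries (ArcRing (Fin 6)), 2 * y ∈ coeffSubalgebra A →
      y ∈ coeffSubalgebra A := by
    intro y hy
    have := (coeffSubalgebra A).smul_mem hy (2 : ℂ)⁻¹
    rwa [two_mul, ← two_smul ℂ, smul_smul, inv_mul_cancel₀ two_ne_zero, one_smul] at this
  have g0 : x 0 * x 0 ∈ coeffSubalgebra A := by
    simpa [gramMap, copyQuad, sliceMap] using hg 0
  have g1 : x 1 * x 1 + x 2 ∈ coeffSubalgebra A := by
    simpa [gramMap, copyQuad, sliceMap] using hg 1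
  have g3 : 2 * (x 1 * x 3) + x 5 + x 2 * x 4 ∈ coeffSubalgebra A := by
    have := hg 3
    simpa [gramMap, copyPolar, sliceMap, two_smul, two_mul] using this
  have g4 : x 0 * (2 * x 3) ∈ coeffSubalgebra A := by
    have := hg 4
    have h : x 0 * (2 * x 3) = x 0 * x 3 + x 0 * x 3 := by ring
    rw [h]
    simpa [gramMap, copyPolar, sliceMap, two_smul] using this
  have g5 : x 0 * (2 * x 1) ∈ coeffSubalgebra A := by
    have := hg 5
    have h : x 0 * (2 * x 1) = x 0 * x 1 + x 0 * x 1 := by ring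
    rw [h]
    simpa [gramMap, copyPolar, sliceMap, two_smul] using this
  have g6 : x 0 * (x 5 - x 2 * x 4) ∈ coeffSubalgebra A := by
    simpa [gramMap, copyDet, sliceMap] using hg 6
  have hd0 : ∀ r, PowerSeries.coeff 0 (x 0) * r ∈ A → r ∈ A := by
    intro r hr
    rw [hx0] at hr
    refine hdiv r ?_
    have hD : (4 : ℂ) • (X (0, 0) ^ 2 * X (2, 0)) ∈ A := by
      have := hle (gramSliceMap_mem ((4 : ℂ) • (X (0, 0) * X (1, 0)) - X (5, 0) * X (5, 0)))
      have heq : gramSliceMap ((4 : ℂ) • (X (0, 0) * X (1, 0)) - X (5, 0) * X (5, 0)) =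
          (4 : ℂ) • (X (0, 0) ^ 2 * X (2, 0)) := by
        have h2' : (C 2 : ArcRing (Fin 6)) = 2 := map_ofNat _ 2
        have h4' : (C 4 : ArcRing (Fin 6)) = 4 := map_ofNat _ 4
        simp [gramSliceMap, arcMap_X, gramMap, copyQuad, copyPolar, sliceMap, toArc,
          smul_eq_C_mul, h2', h4']
        ring
      rwa [heq] at this
    -- The middle factor is the image of `4 X₀ X₁ - X₅²`, so the right side already lies in `A`.
    have : e * r = X (0, 0) * ((4 : ℂ) • (X (0, 0) ^ 2 * X (2, 0))) * (X (0, 0) * r) := by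
      rw [he']
      simp only [smul_eq_C_mul]
      ring
    rw [this]
    exact A.mul_mem (A.mul_mem h00 hD) hr
  have hd2 : ∀ r, PowerSeries.coeff 0 (x 2) * r ∈ A → r ∈ A := by
    intro r hr
    rw [hx2] at hr
    refine hdiv r ?_
    have : e * r = (4 : ℂ) • (X (0, 0) ^ 4 * (X (2, 0) * r)) := by
      rw [he']
      simp only [smul_eq_C_mul]
      ring
    rw [this]
    exact A.smul_mem (A.mul_mem (A.pow_mem h00 4) hr) _
  -- Solving for the slice coordinates: `s` from `s²`; `u` and `p` from `2 s u` and `2 s p`; `w`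
  -- from `u² + w`; `n` and `w m` from their sum and difference; `m` on division by `w`.
  have m0 : x 0 ∈ coeffSubalgebra A :=
    mem_coeffSubalgebra_of_mul_self (by rwa [hx0]) g0 hd0
  have m1 : x 1 ∈ coeffSubalgebra A := half _ (mem_coeffSubalgebra_of_mul m0 g5 hd0)
  have m3 : x 3 ∈ coeffSubalgebra A := half _ (mem_coeffSubalgebra_of_mul m0 g4 hd0)
  have m2 : x 2 ∈ coeffSubalgebra A := by
    have := sub_mem g1 (mul_mem m1 m1)
    rwa [add_sub_cancel_left] at this
  have m6 := mem_coeffSubalgebra_of_mul m0 g6 hd0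
  have m13 : 2 * (x 1 * x 3) ∈ coeffSubalgebra A := by
    rw [two_mul]
    exact add_mem (mul_mem m1 m3) (mul_mem m1 m3)
  have m7 : x 5 + x 2 * x 4 ∈ coeffSubalgebra A := by
    have := sub_mem g3 m13
    rwa [add_assoc, add_sub_cancel_left] at this
  have m5 : x 5 ∈ coeffSubalgebra A := by
    refine half _ ?_
    have := add_mem m7 m6
    have h : x 5 + x 2 * x 4 + (x 5 - x 2 * x 4) = 2 * x 5 := by ring
    rwa [h] at this
  have m4 : x 4 ∈ coeffSubalgebra A := by
    refine mem_coeffSubalgebra_of_mul m2 ?_ hd2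
    have := sub_mem m7 m5
    rwa [add_sub_cancel_left] at this
  have hall : ∀ j, x j ∈ coeffSubalgebra A := by
    intro j
    fin_cases j
    exacts [m0, m1, m2, m3, m4, m5]
  rw [eq_top_iff, ← adjoin_range_X, Algebra.adjoin_le_iff]
  rintro _ ⟨⟨j, k⟩, rfl⟩
  have := A.smul_mem (hall j k) (k.factorial : ℂ)
  rw [hx, genericArc, PowerSeries.coeff_mk, smul_eq_C_mul, ← mul_assoc, ← C_mul,
    mul_inv_cancel₀ (Nat.cast_ne_zero.2 k.factorial_ne_zero), C_1, one_mul] at this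
  exact this

/-! ### Conjugating generic arcs into the slice -/

section Points

lemma constantCoeff_two : PowerSeries.constantCoeff (2 : PowerSeries ℂ) = 2 := map_ofNat _ 2

lemma constantCoeff_four : PowerSeries.constantCoeff (4 : PowerSeries ℂ) = 4 := map_ofNat _ 4

lemma constantCoeff_ne_zero_mul_inv {f : PowerSeries ℂ} (hf : PowerSeries.constantCoeff f ≠ 0) :
    ∃ g : PowerSeries ℂ, f * g = 1 :=
  ⟨f⁻¹, PowerSeries.mul_inv_cancel f hf⟩

/-- The arc in the slice with given coordinates. -/
def sliceArc (z : Fin 6 → PowerSeries ℂ) (p : Σ _ : Fin 3, Fin 3) : PowerSeries ℂ :=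
  aeval z (sliceMap p)

lemma sliceArc_apply (z : Fin 6 → PowerSeries ℂ) (p : Σ _ : Fin 3, Fin 3) : sliceArc z p =
    ![![z 0, 0, 0], ![z 1, 1, z 2], ![z 3, z 4, z 5]] p.1 p.2 := by
  obtain ⟨m, i⟩ := p
  fin_cases m <;> fin_cases i <;> simp [sliceArc, sliceMap]

lemma arcEval_arcMap_gramMap_eq {v v' : (Σ _ : Fin 3, Fin 3) → PowerSeries ℂ}
    (h : ∀ F ∈ currentInvariants 3, arcEval v F = arcEval v' F) (G : ArcRing (Fin 7)) :
    arcEval v (arcMap gramMap G) = arcEval v' (arcMap gramMap G) :=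
  h _ (differentialSpan_le_currentInvariants 3 (arcMap_gramMap_mem G))

lemma arcEval_gramMinor (v : (Σ _ : Fin 3, Fin 3) → PowerSeries ℂ) :
    arcEval v (arcMap gramMap (toArc (Fin 7) (gramMinor 0 1 5))) =
      PowerSeries.constantCoeff ((v ⟨0, 0⟩ * v ⟨0, 0⟩ + v ⟨0, 1⟩ * v ⟨0, 2⟩) *
        (4 * ((v ⟨0, 0⟩ * v ⟨0, 0⟩ + v ⟨0, 1⟩ * v ⟨0, 2⟩) *
          (v ⟨1, 0⟩ * v ⟨1, 0⟩ + v ⟨1, 1⟩ * v ⟨1, 2⟩)) -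
          (2 * (v ⟨0, 0⟩ * v ⟨1, 0⟩) + v ⟨0, 1⟩ * v ⟨1, 2⟩ + v ⟨0, 2⟩ * v ⟨1, 1⟩) ^ 2)) := by
  rw [arcMap_toArc, arcEval_toArc]
  have h2 : (PowerSeries.C 2 : PowerSeries ℂ) = 2 := map_ofNat _ 2
  have h4 : (PowerSeries.C 4 : PowerSeries ℂ) = 4 := map_ofNat _ 4
  have e0 : aeval v (gramMap 0) = v ⟨0, 0⟩ * v ⟨0, 0⟩ + v ⟨0, 1⟩ * v ⟨0, 2⟩ := by
    simp [gramMap, copyQuad]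
  have e1 : aeval v (gramMap 1) = v ⟨1, 0⟩ * v ⟨1, 0⟩ + v ⟨1, 1⟩ * v ⟨1, 2⟩ := by
    simp [gramMap, copyQuad]
  have e5 : aeval v (gramMap 5) =
      2 * (v ⟨0, 0⟩ * v ⟨1, 0⟩) + v ⟨0, 1⟩ * v ⟨1, 2⟩ + v ⟨0, 2⟩ * v ⟨1, 1⟩ := by
    change aeval v (copyPolar 0 1) = _
    simp only [copyPolar, map_add, map_smul, map_mul, aeval_X, PowerSeries.smul_eq_C_mul, h2]
  congr 1
  simp only [gramMinor, map_sub, map_smul, map_mul, aeval_X, e0, e1, e5,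
    PowerSeries.smul_eq_C_mul, h4, sq]

/-- A generic triple of arcs is conjugate to a triple in the slice. -/
lemma exists_sliceArc {v : (Σ _ : Fin 3, Fin 3) → PowerSeries ℂ} {s : PowerSeries ℂ}
    (hs : s * s = v ⟨0, 0⟩ * v ⟨0, 0⟩ + v ⟨0, 1⟩ * v ⟨0, 2⟩)
    (hα : PowerSeries.constantCoeff (s + v ⟨0, 0⟩) ≠ 0)
    (he : arcEval v (arcMap gramMap (toArc (Fin 7) (gramMinor 0 1 5))) ≠ 0) :
    ∃ z : Fin 6 → PowerSeries ℂ, z 0 = s ∧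
      ∀ F ∈ currentInvariants 3, arcEval v F = arcEval (sliceArc z) F := by
  have hs0 : PowerSeries.constantCoeff s ≠ 0 := by
    intro h0
    apply he
    rw [arcEval_gramMinor, ← hs]
    simp [h0]
  obtain ⟨a, ha⟩ := constantCoeff_ne_zero_mul_inv hα
  obtain ⟨b, hb⟩ := constantCoeff_ne_zero_mul_inv (f := 2 * s) (by
    rw [map_mul]
    exact mul_ne_zero (by simp [constantCoeff_two]) hs0)
  -- The parameter `-y / (s + h)` in the coordinates of the first vector is a root of the quadratic
  -- equation for its new `y`-coordinate; the new `h`-coordinate is then `s`.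
  obtain ⟨v₁, hv₁⟩ : ∃ w, w = lowerMove (-(v ⟨0, 2⟩ * a)) v := ⟨_, rfl⟩
  have h10 : v₁ ⟨0, 0⟩ = s := by
    simp [hv₁, lowerMove]
    linear_combination (s - v ⟨0, 0⟩) * ha - a * hs
  have h12 : v₁ ⟨0, 2⟩ = 0 := by
    simp [hv₁, lowerMove]
    linear_combination (-v ⟨0, 2⟩ * (a * (s - v ⟨0, 0⟩) + 1)) * ha + v ⟨0, 2⟩ * a ^ 2 * hs
  -- As `2 s` is a unit, the remaining `x`-coordinate of the first vector can be removed as well.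
  obtain ⟨v₂, hv₂⟩ : ∃ w, w = upperMove (v₁ ⟨0, 1⟩ * b) v₁ := ⟨_, rfl⟩
  have h20 : v₂ ⟨0, 0⟩ = s := by simp [hv₂, upperMove, h10, h12]
  have h21 : v₂ ⟨0, 1⟩ = 0 := by
    simp [hv₂, upperMove, h10, h12]
    linear_combination (-v₁ ⟨0, 1⟩) * hb
  have h22 : v₂ ⟨0, 2⟩ = 0 := by simp [hv₂, upperMove, h12]
  have hF2 : ∀ F ∈ currentInvariants 3, arcEval v F = arcEval v₂ F := by
    intro F hF
    rw [hv₂, arcEval_upperMove hF, hv₁, arcEval_lowerMove hF]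
  -- With the first vector equal to `s h`, the minor is `4 s⁴` times the product of the `x`- and
  -- `y`-coordinates of the second vector.
  have hβ : PowerSeries.constantCoeff (v₂ ⟨1, 1⟩) ≠ 0 := by
    intro h0
    apply he
    rw [arcEval_arcMap_gramMap_eq hF2, arcEval_gramMinor, h20, h21, h22]
    simp [h0, constantCoeff_two, constantCoeff_four]
    right
    ring
  obtain ⟨r, hr⟩ := exists_mul_self_eq hβ
  have hr0 : PowerSeries.constantCoeff r ≠ 0 := by
    intro h0
    apply hβ
    rw [← hr]
    simp [h0]
  obtain ⟨f, hf⟩ := constantCoeff_ne_zero_mul_inv hr0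
  have hf' : f * r = 1 := by rw [mul_comm, hf]
  -- Two Weyl elements compose to a torus element, which scales `x`-coordinates by `r⁻²` and
  -- `y`-coordinates by `r²`; as `r²` is the `x`-coordinate of the second vector, that coordinate
  -- becomes `1`.
  obtain ⟨v₃, hv₃⟩ : ∃ w, w = weylMove f r (weylMove 1 1 v₂) := ⟨_, rfl⟩
  have hF3 : ∀ F ∈ currentInvariants 3, arcEval v F = arcEval v₃ F := by
    intro F hF
    rw [hv₃, arcEval_weylMove hF hf', arcEval_weylMove hF (one_mul 1), hF2 F hF]
  have hv₃0 : ∀ m, v₃ ⟨m, 0⟩ = v₂ ⟨m, 0⟩ := by simp [hv₃, weylMove]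
  have hv₃1 : ∀ m, v₃ ⟨m, 1⟩ = f ^ 2 * v₂ ⟨m, 1⟩ := by simp [hv₃, weylMove]
  have hv₃2 : ∀ m, v₃ ⟨m, 2⟩ = r ^ 2 * v₂ ⟨m, 2⟩ := by simp [hv₃, weylMove]
  refine ⟨![s, v₃ ⟨1, 0⟩, v₃ ⟨1, 2⟩, v₃ ⟨2, 0⟩, v₃ ⟨2, 1⟩, v₃ ⟨2, 2⟩], rfl, fun F hF => ?_⟩
  rw [hF3 F hF]
  congr 2
  funext p
  rw [sliceArc_apply]
  obtain ⟨m, i⟩ := p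
  fin_cases m <;> fin_cases i
  · simp [hv₃0, h20]
  · simp [hv₃1, h21]
  · simp [hv₃2, h22]
  · simp
  · simp [hv₃1, ← hr]
    linear_combination (f * r + 1) * hf'
  · simp
  · simp
  · simp
  · simp

lemma arcMap_gramMap_gramMinor_ne_zero :
    arcMap gramMap (toArc (Fin 7) (gramMinor 0 1 5)) ≠ 0 := by
  intro h
  have h1 := arcEval_gramMinor (fun p : Σ _ : Fin 3, Fin 3 =>
    (![![1, 0, 0], ![0, 1, 1], ![0, 0, 0]] p.1 p.2 : PowerSeries ℂ))
  rw [h] at h1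
  simp [constantCoeff_four] at h1

/-- On the open set where the minor does not vanish, the invariants are functions of the Gram
matrix and the determinant. -/
theorem exists_gramMinor_pow_mul_eq {F : ArcRing (Σ _ : Fin 3, Fin 3)}
    (hF : F ∈ currentInvariants 3) : ∃ (N : ℕ) (G : ArcRing (Fin 7)),
      arcMap gramMap (toArc (Fin 7) (gramMinor 0 1 5)) ^ N * F = arcMap gramMap G := by
  have hmem : arcMap sliceMap F ∈ saturation gramSliceAlgebra
      (gramSliceMap_mem (toArc (Fin 7) (gramMinor 0 1 5))) := by
    rw [saturation_gramSliceAlgebra_eq_top]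
    trivial
  obtain ⟨N, h₀, h₁, hN⟩ := hmem
  refine ⟨N, h₀, ?_⟩
  have key : ∀ (v : (Σ _ : Fin 3, Fin 3) → PowerSeries ℂ) (s : PowerSeries ℂ),
      s * s = v ⟨0, 0⟩ * v ⟨0, 0⟩ + v ⟨0, 1⟩ * v ⟨0, 2⟩ →
      PowerSeries.constantCoeff (s + v ⟨0, 0⟩) ≠ 0 →
      arcEval v (arcMap gramMap (toArc (Fin 7) (gramMinor 0 1 5))) ≠ 0 →
      arcEval v (arcMap gramMap (toArc (Fin 7) (gramMinor 0 1 5)) ^ N * F) =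
        arcEval v (arcMap gramMap h₀) +
          PowerSeries.constantCoeff s * arcEval v (arcMap gramMap h₁) := by
    intro v s hs hα he
    obtain ⟨z, hz, hzF⟩ := exists_sliceArc hs hα he
    have hz' : ∀ G, arcEval (sliceArc z) G = arcEval z (arcMap sliceMap G) := by
      intro G
      rw [arcEval_arcMap]
      rfl
    have hg : ∀ G, arcEval v (arcMap gramMap G) = arcEval z (gramSliceMap G) := by
      intro G
      rw [arcEval_arcMap_gramMap_eq hzF, hz', arcMap_sliceMap_gramMap]
    rw [map_mul, map_pow, hg, hzF F hF, hz', ← map_pow, ← map_mul, hN, map_add, map_mul, hg, hg,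
      arcEval_X, hz]
    simp
  -- The extra factor makes `(s + h)(s - h) = x y` a unit for the first vector, so that both square
  -- roots `s` and `-s` are admissible.
  have hne : toArc _ (X ⟨0, 1⟩ * X ⟨0, 2⟩ : MvPolynomial (Σ _ : Fin 3, Fin 3) ℂ) *
      arcMap gramMap (toArc (Fin 7) (gramMinor 0 1 5)) ≠ 0 := by
    refine mul_ne_zero ?_ arcMap_gramMap_gramMinor_ne_zero
    rw [map_mul, toArc, rename_X, rename_X]
    exact mul_ne_zero (X_ne_zero _) (X_ne_zero _)
  refine arcRing_ext_of_ne_zero hne fun v hv => ?_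
  rw [map_mul] at hv
  have he := right_ne_zero_of_mul hv
  have hβγ := left_ne_zero_of_mul hv
  rw [arcEval_toArc] at hβγ
  have hA : PowerSeries.constantCoeff (v ⟨0, 0⟩ * v ⟨0, 0⟩ + v ⟨0, 1⟩ * v ⟨0, 2⟩) ≠ 0 := by
    intro h0
    apply he
    rw [arcEval_gramMinor, map_mul, h0, zero_mul]
  obtain ⟨s, hs⟩ := exists_mul_self_eq hA
  have hprod : PowerSeries.constantCoeff ((s + v ⟨0, 0⟩) * (s - v ⟨0, 0⟩)) ≠ 0 := by
    have h : (s + v ⟨0, 0⟩) * (s - v ⟨0, 0⟩) = v ⟨0, 1⟩ * v ⟨0, 2⟩ := by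
      linear_combination hs
    rw [h]
    simpa using hβγ
  rw [map_mul] at hprod
  have k1 := key v s hs (left_ne_zero_of_mul hprod) he
  have k2 := key v (-s) (by rw [neg_mul_neg, hs]) (by
    have := right_ne_zero_of_mul hprod
    rw [← neg_ne_zero, ← map_neg] at this
    rwa [neg_sub', sub_neg_eq_add] at this) he
  rw [map_neg] at k2
  -- The left side does not depend on the choice of the root, so the term linear in `s` cancels in
  -- the average.
  linear_combination (k1 + k2) / 2

end Points

/-! ### The relations between the Gram matrix and the determinant -/

lemma arcMap_gramMap_gramEquation (k : ℕ) : arcMap gramMap (gramEquation k) = 0 := by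
  rw [gramEquation, coeff_aeval_genericArc, map_mul, arcMap_iterate_arcD,
    aeval_gramMap_gramRelation, map_zero, iterate_map_zero, mul_zero]

lemma arcMap_gramMap_of_mem {F : ArcRing (Fin 7)} (hF : F ∈ gramIdeal) :
    arcMap gramMap F = 0 := by
  have : gramIdeal ≤ RingHom.ker (arcMap gramMap) := by
    rw [gramIdeal, Ideal.span_le]
    rintro _ ⟨k, rfl⟩
    exact arcMap_gramMap_gramEquation k
  exact this hF

/-- Generic values of the Gram matrix and the determinant, apart from the last diagonal entry, are
attained on the slice. -/
lemma exists_sliceArc_gramMap {z : Fin 7 → PowerSeries ℂ}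
    (hz : arcEval z (toArc (Fin 7) (gramMinor 0 1 5)) ≠ 0) :
    ∃ v : (Σ _ : Fin 3, Fin 3) → PowerSeries ℂ, ∀ j ≠ 2, aeval v (gramMap j) = z j := by
  have h2 : (PowerSeries.C 2 : PowerSeries ℂ) = 2 := map_ofNat _ 2
  have h4 : (PowerSeries.C 4 : PowerSeries ℂ) = 4 := map_ofNat _ 4
  rw [arcEval_toArc] at hz
  simp only [gramMinor, map_sub, map_smul, map_mul, aeval_X, PowerSeries.smul_eq_C_mul, h4] at hz
  obtain ⟨s, hs⟩ := exists_mul_self_eq (left_ne_zero_of_mul hz)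
  have hs0 : PowerSeries.constantCoeff s ≠ 0 := by
    intro h0
    apply left_ne_zero_of_mul hz
    rw [← hs, map_mul, h0, zero_mul]
  obtain ⟨t, ht⟩ := constantCoeff_ne_zero_mul_inv hs0
  obtain ⟨c, hc⟩ := constantCoeff_ne_zero_mul_inv (f := 2) (by simp [constantCoeff_two])
  obtain ⟨u, hu⟩ : ∃ u, u = z 5 * t * c := ⟨_, rfl⟩
  obtain ⟨w, hw⟩ : ∃ w, w = z 1 - u * u := ⟨_, rfl⟩
  obtain ⟨p, hp⟩ : ∃ p, p = z 4 * t * c := ⟨_, rfl⟩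
  have hsu : 2 * (s * u) = z 5 := by
    rw [hu]
    linear_combination z 5 * 2 * c * ht + z 5 * hc
  have hsp : 2 * (s * p) = z 4 := by
    rw [hp]
    linear_combination z 4 * 2 * c * ht + z 4 * hc
  have hw0 : PowerSeries.constantCoeff w ≠ 0 := by
    intro h0
    apply right_ne_zero_of_mul hz
    have : 4 * (z 0 * z 1) - z 5 * z 5 = 4 * z 0 * w := by
      rw [hw, ← hsu, ← hs]
      ring
    rw [← map_mul, ← map_mul, ← map_mul, ← map_sub, this, map_mul, h0, mul_zero]
  obtain ⟨w', hw'⟩ := constantCoeff_ne_zero_mul_inv hw0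
  -- On the slice the last polar form gives `n + w m = z 3 - 2 u p` and the determinant gives `s (n
  -- - w m) = z 6`; here `c = 1/2` and `t = s⁻¹`.
  obtain ⟨n, hn⟩ : ∃ n, n = c * (z 3 - 2 * (u * p) + z 6 * t) := ⟨_, rfl⟩
  obtain ⟨m, hm⟩ : ∃ m, m = w' * (c * (z 3 - 2 * (u * p) - z 6 * t)) := ⟨_, rfl⟩
  have hwm : w * m = c * (z 3 - 2 * (u * p) - z 6 * t) := by
    rw [hm, ← mul_assoc, hw', one_mul]
  refine ⟨fun q => ![![s, 0, 0], ![u, 1, w], ![p, m, n]] q.1 q.2, fun j hj => ?_⟩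
  fin_cases j
  · simp [gramMap, copyQuad, hs]
  · simp [gramMap, copyQuad, hw]
  · exact absurd rfl hj
  · change aeval _ (copyPolar 1 2) = _
    simp only [copyPolar, map_add, map_smul, map_mul, aeval_X, PowerSeries.smul_eq_C_mul, h2]
    simp
    linear_combination hn + hwm + (z 3 - 2 * (u * p)) * hc
  · change aeval _ (copyPolar 0 2) = _
    simp only [copyPolar, map_add, map_smul, map_mul, aeval_X, PowerSeries.smul_eq_C_mul, h2]
    simpa using hsp
  · change aeval _ (copyPolar 0 1) = _
    simp only [copyPolar, map_add, map_smul, map_mul, aeval_X, PowerSeries.smul_eq_C_mul, h2]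
    simpa using hsu
  · change aeval _ copyDet = _
    simp [copyDet]
    linear_combination s * hn - s * hwm + 2 * c * z 6 * ht + z 6 * hc

/-- Apart from the last diagonal entry, the Gram data take generic values freely on arcs, so they
and their derivatives are algebraically independent. -/
lemma eq_zero_of_mem_supported {F : ArcRing (Fin 7)}
    (hF : F ∈ supported ℂ {x : Fin 7 × ℕ | x.1 ≠ 2}) (h : arcMap gramMap F = 0) : F = 0 := by
  have hne : toArc (Fin 7) (gramMinor 0 1 5) ≠ 0 := by
    intro h0
    apply arcMap_gramMap_gramMinor_ne_zero
    rw [h0, map_zero]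
  refine arcRing_ext_of_ne_zero hne fun z hz => ?_
  obtain ⟨v, hv⟩ := exists_sliceArc_gramMap hz
  have heq : supported ℂ {x : Fin 7 × ℕ | x.1 ≠ 2} ≤
      AlgHom.equalizer (arcEval z) (arcEval fun j => aeval v (gramMap j)) := by
    refine Algebra.adjoin_le ?_
    rintro _ ⟨⟨j, k⟩, hj, rfl⟩
    change arcEval z (X (j, k)) = arcEval _ (X (j, k))
    rw [arcEval_X, arcEval_X, hv j hj]
  rw [show arcEval z F = arcEval (fun j => aeval v (gramMap j)) F from heq hF, ← arcEval_arcMap, h,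
    map_zero, map_zero]

/-- On the open set where the minor does not vanish, the Gram relation eliminates the last diagonal
entry of the Gram matrix. -/
lemma exists_sub_mem_gramIdeal (F : ArcRing (Fin 7)) :
    ∃ N : ℕ, ∃ G ∈ supported ℂ {x : Fin 7 × ℕ | x.1 ≠ 2},
      toArc (Fin 7) (gramMinor 0 1 5) ^ N * F - G ∈ gramIdeal := by
  set q := Ideal.Quotient.mkₐ ℂ gramIdeal with hq
  set B := (supported ℂ {x : Fin 7 × ℕ | x.1 ≠ 2}).map q with hB
  have hX : ∀ j ≠ 2, ∀ k, (X (j, k) : ArcRing (Fin 7)) ∈ supported ℂ {x : Fin 7 × ℕ | x.1 ≠ 2} :=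
    fun j hj k => Algebra.subset_adjoin ⟨(j, k), hj, rfl⟩
  have hΔ : (4 : ℂ) • (X (0, 0) * X (1, 0)) - X (5, 0) * X (5, 0) ∈
      supported ℂ {x : Fin 7 × ℕ | x.1 ≠ 2} :=
    sub_mem (Subalgebra.smul_mem _ (mul_mem (hX 0 (by decide) 0) (hX 1 (by decide) 0)) _)
      (mul_mem (hX 5 (by decide) 0) (hX 5 (by decide) 0))
  have he : q (toArc (Fin 7) (gramMinor 0 1 5)) ∈ B := by
    rw [toArc_gramMinor]
    exact ⟨_, mul_mem (hX 0 (by decide) 0) hΔ, rfl⟩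
  -- The claim amounts to `A` being the whole quotient ring: every class enters `B` after
  -- multiplication by a power of `e`.
  set A := saturation B he with hA
  have hBA : B ≤ A := le_saturation B he
  set x : Fin 7 → PowerSeries (ArcRing (Fin 7) ⧸ gramIdeal) := fun j =>
    PowerSeries.map (q : ArcRing (Fin 7) →+* ArcRing (Fin 7) ⧸ gramIdeal) (genericArc (Fin 7) j)
    with hx
  have hxc : ∀ j k, PowerSeries.coeff k (x j) = q (C (k.factorial : ℂ)⁻¹ * X (j, k)) := by
    intro j k
    simp [hx, genericArc]
  have hxj : ∀ j ≠ 2, x j ∈ coeffSubalgebra A := by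
    intro j hj k
    rw [hxc, ← smul_eq_C_mul]
    exact hBA ⟨_, Subalgebra.smul_mem _ (hX j hj k) _, rfl⟩
  have hrel : aeval x gramRelation = 0 := by
    rw [hx, aeval_map_series]
    ext k
    rw [PowerSeries.coeff_map, map_zero]
    exact Ideal.Quotient.eq_zero_iff_mem.2 (Ideal.subset_span ⟨k, rfl⟩)
  -- The Gram relation is linear in the last diagonal entry, and its coefficient there is a factor
  -- of the minor; long division then yields all derivatives of that entry.
  have hrel' : ((4 : ℂ) • (x 0 * x 1) - x 5 * x 5) * x 2 = x 0 * x 3 * x 3 + x 1 * x 4 * x 4 -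
      x 6 * x 6 - x 3 * x 4 * x 5 := by
    simp only [gramRelation, map_add, map_sub, map_mul, map_smul, aeval_X] at hrel
    have hs : ((4 : ℂ) • (x 0 * x 1) - x 5 * x 5) * x 2 =
        (4 : ℂ) • (x 0 * x 1 * x 2) - x 5 * x 5 * x 2 := by
      rw [sub_mul, smul_mul_assoc]
    rw [hs]
    linear_combination hrel
  have hx2 : x 2 ∈ coeffSubalgebra A := by
    have m0 := hxj 0 (by decide)
    have m1 := hxj 1 (by decide)
    have m3 := hxj 3 (by decide)
    have m4 := hxj 4 (by decide)
    have m5 := hxj 5 (by decide)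
    have m6 := hxj 6 (by decide)
    refine mem_coeffSubalgebra_of_mul
      (sub_mem (Subalgebra.smul_mem _ (mul_mem m0 m1) (4 : ℂ)) (mul_mem m5 m5)) ?_ ?_
    · rw [hrel']
      exact sub_mem (sub_mem (add_mem (mul_mem (mul_mem m0 m3) m3) (mul_mem (mul_mem m1 m4) m4))
        (mul_mem m6 m6)) (mul_mem (mul_mem m3 m4) m5)
    · intro r hr
      refine mem_saturation_of_mul_mem he ?_
      have hc0 : PowerSeries.coeff 0 ((4 : ℂ) • (x 0 * x 1) - x 5 * x 5) =
          q ((4 : ℂ) • (X (0, 0) * X (1, 0)) - X (5, 0) * X (5, 0)) := by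
        have h0 : ∀ j, PowerSeries.constantCoeff (x j) = q (X (j, 0)) := by
          intro j
          rw [← PowerSeries.coeff_zero_eq_constantCoeff_apply, hxc]
          simp
        have hsm : PowerSeries.coeff 0 ((4 : ℂ) • (x 0 * x 1)) =
            (4 : ℂ) • PowerSeries.coeff 0 (x 0 * x 1) := rfl
        rw [map_sub, hsm]
        simp only [PowerSeries.coeff_zero_eq_constantCoeff_apply, map_mul, h0, map_sub, map_smul]
      rw [hc0] at hr
      have heq : q (toArc (Fin 7) (gramMinor 0 1 5)) * r = q (X (0, 0)) *
          (q ((4 : ℂ) • (X (0, 0) * X (1, 0)) - X (5, 0) * X (5, 0)) * r) := by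
        rw [toArc_gramMinor, map_mul, mul_assoc]
      have hx0 : q (X (0, 0)) ∈ A := hBA ⟨_, hX 0 (by decide) 0, rfl⟩
      have hm := mul_mem hx0 hr
      rw [← heq] at hm
      exact hm
  have hall : ∀ j, x j ∈ coeffSubalgebra A := by
    intro j
    by_cases hj : j = 2
    · rw [hj]
      exact hx2
    · exact hxj j hj
  have htop : ∀ F : ArcRing (Fin 7), q F ∈ A := by
    intro F
    induction F using MvPolynomial.induction_on with
    | C a =>
      rw [MvPolynomial.algHom_C]
      exact Subalgebra.algebraMap_mem _ _
    | add p p' hp hp' =>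
      rw [map_add]
      exact add_mem hp hp'
    | mul_X p y hp =>
      rw [map_mul]
      refine mul_mem hp ?_
      obtain ⟨j, k⟩ := y
      have := A.smul_mem (hall j k) (k.factorial : ℂ)
      rw [hxc, ← map_smul, smul_eq_C_mul, ← mul_assoc, ← C_mul,
        mul_inv_cancel₀ (Nat.cast_ne_zero.2 k.factorial_ne_zero), C_1, one_mul] at this
      exact this
  obtain ⟨N, G, hG, hN⟩ := htop F
  refine ⟨N, G, hG, ?_⟩
  rw [← map_pow, ← map_mul] at hN
  exact Ideal.Quotient.eq.1 hN.symm

/-- The Gram relation and its derivatives generate all relations between the derivatives of the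
Gram matrix and the determinant. -/
theorem mem_gramIdeal_iff {F : ArcRing (Fin 7)} : F ∈ gramIdeal ↔ arcMap gramMap F = 0 := by
  refine ⟨arcMap_gramMap_of_mem, fun hF => ?_⟩
  -- Modulo `gramIdeal`, a power of `e` times `F` is a polynomial in independent functions; it maps
  -- to zero and so vanishes. Regularity of `e` then removes the power.
  obtain ⟨N, G, hG, hN⟩ := exists_sub_mem_gramIdeal F
  have hG0 : G = 0 := by
    refine eq_zero_of_mem_supported hG ?_
    have := arcMap_gramMap_of_mem hN
    rw [map_sub, map_mul, hF, mul_zero, zero_sub, neg_eq_zero] at this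
    exact this
  rw [hG0, sub_zero, mul_comm] at hN
  exact mem_gramIdeal_of_mul_mem hN

/-! ### Change of copies -/

section Copies

variable {n m : ℕ}

lemma iterate_arcD_toArc_X {ι : Type*} (i : ι) (k : ℕ) :
    (arcD ι)^[k] (toArc ι (X i)) = X (i, k) := by
  have := arcMap_X (fun i => (X i : MvPolynomial ι ℂ)) i k
  rw [← this, arcMap_id]

/-- The homomorphism of arc rings which substitutes copies of `𝔰𝔩₂`. -/
def copiesMap (τ : Fin n → Fin m) :
    ArcRing (Σ _ : Fin n, Fin 3) →ₐ[ℂ] ArcRing (Σ _ : Fin m, Fin 3) :=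
  arcMap fun p => X ⟨τ p.1, p.2⟩

lemma copiesMap_X (τ : Fin n → Fin m) (p : Σ _ : Fin n, Fin 3) (k : ℕ) :
    copiesMap τ (X (p, k)) = X (⟨τ p.1, p.2⟩, k) := by
  rw [copiesMap, arcMap_X, iterate_arcD_toArc_X]

lemma monomialAction_copiesMap (τ : Fin n → Fin m) (r : ℕ) (ξ : Sl2)
    (F : ArcRing (Σ _ : Fin n, Fin 3)) :
    monomialAction (lieCopies (LieAlgebra.ad ℂ Sl2) m) (copiesBasis m) r ξ (copiesMap τ F) =
      copiesMap τ (monomialAction (lieCopies (LieAlgebra.ad ℂ Sl2) n) (copiesBasis n) r ξ F) := by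
  induction F using MvPolynomial.induction_on with
  | C a =>
    rw [MvPolynomial.algHom_C, Derivation.map_algebraMap, ← MvPolynomial.algebraMap_eq,
      Derivation.map_algebraMap, map_zero]
  | add p q hp hq => simp only [map_add, hp, hq]
  | mul_X p x hp =>
    obtain ⟨⟨i, j⟩, k⟩ := x
    rw [map_mul, Derivation.leibniz, Derivation.leibniz, hp, copiesMap_X, monomialAction_X,
      monomialAction_X, dualForm_copies, dualForm_copies]
    simp only [smul_eq_mul, map_add, map_mul, map_smul, map_neg, map_sum, copiesMap_X]

lemma copiesMap_mem (τ : Fin n → Fin m) {F : ArcRing (Σ _ : Fin n, Fin 3)}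
    (hF : F ∈ currentInvariants n) : copiesMap τ F ∈ currentInvariants m := by
  rw [currentInvariants, mem_arcInvariants_iff] at hF ⊢
  intro r ξ
  rw [monomialAction_copiesMap, hF, map_zero]

end Copies

/-! ### Three copies -/

/-- A cyclic permutation of the copies permutes the Gram entries and, being even, fixes the
determinant. -/
lemma aeval_cyclic_gramMap (j : Fin 7) :
    aeval (fun p : Σ _ : Fin 3, Fin 3 =>
      (X ⟨![2, 0, 1] p.1, p.2⟩ : MvPolynomial (Σ _ : Fin 3, Fin 3) ℂ)) (gramMap j) =
        gramMap (![2, 0, 1, 5, 3, 4, 6] j) := by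
  fin_cases j
  · simp [gramMap, copyQuad]
  · simp [gramMap, copyQuad]
  · simp [gramMap, copyQuad]
  · simp [gramMap, copyPolar]
  · change aeval _ (copyPolar 0 2) = copyPolar 1 2
    simp [copyPolar]
    rw [mul_comm (X ⟨2, 0⟩ : MvPolynomial (Σ _ : Fin 3, Fin 3) ℂ)]
    ring
  · change aeval _ (copyPolar 0 1) = copyPolar 0 2
    simp [copyPolar]
    rw [mul_comm (X ⟨2, 0⟩ : MvPolynomial (Σ _ : Fin 3, Fin 3) ℂ)]
    ring
  · change aeval _ copyDet = copyDet
    simp [copyDet]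
    ring

lemma copiesMap_cyclic_arcMap_gramMap (G : ArcRing (Fin 7)) :
    copiesMap ![2, 0, 1] (arcMap gramMap G) =
      arcMap gramMap (arcMap (fun j => (X (![2, 0, 1, 5, 3, 4, 6] j) : MvPolynomial (Fin 7) ℂ))
        G) := by
  rw [copiesMap, arcMap_arcMap, arcMap_arcMap]
  simp only [aeval_cyclic_gramMap, aeval_X]

lemma copiesMap_cyclic_cyclic (F : ArcRing (Σ _ : Fin 3, Fin 3)) :
    copiesMap (![2, 0, 1] : Fin 3 → Fin 3) (copiesMap (![1, 2, 0] : Fin 3 → Fin 3) F) = F := by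
  rw [copiesMap, copiesMap, arcMap_arcMap]
  simp only [aeval_X]
  have h : ∀ i : Fin 3, (![2, 0, 1] : Fin 3 → Fin 3) ((![1, 2, 0] : Fin 3 → Fin 3) i) = i := by
    decide
  simp only [h]
  exact arcMap_id F

/-- The first minor is carried to the second by the cyclic permutation, so the generic statement is
applied to a permuted `F` and transported back. -/
theorem exists_gramMinor_pow_mul_eq' {F : ArcRing (Σ _ : Fin 3, Fin 3)}
    (hF : F ∈ currentInvariants 3) : ∃ (N : ℕ) (G : ArcRing (Fin 7)),
      arcMap gramMap (toArc (Fin 7) (gramMinor 2 0 4)) ^ N * F = arcMap gramMap G := by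
  obtain ⟨N, G, h⟩ := exists_gramMinor_pow_mul_eq (copiesMap_mem ![1, 2, 0] hF)
  have h' := congrArg (copiesMap (![2, 0, 1] : Fin 3 → Fin 3)) h
  rw [map_mul, map_pow, copiesMap_cyclic_cyclic, copiesMap_cyclic_arcMap_gramMap,
    copiesMap_cyclic_arcMap_gramMap, arcMap_toArc _ (gramMinor 0 1 5)] at h'
  have hm : aeval (fun j => (X (![2, 0, 1, 5, 3, 4, 6] j) : MvPolynomial (Fin 7) ℂ))
      (gramMinor 0 1 5) = gramMinor 2 0 4 := by
    simp [gramMinor]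
  rw [hm] at h'
  exact ⟨N, _, h'⟩

/-- A Hartogs argument in algebraic form: `F` is a fraction with denominator a power of `e` and also
one with denominator a power of `e'`, and these powers form a regular sequence modulo the relations.
-/
theorem exists_arcMap_gramMap_eq {F : ArcRing (Σ _ : Fin 3, Fin 3)}
    (hF : F ∈ currentInvariants 3) : ∃ G : ArcRing (Fin 7), F = arcMap gramMap G := by
  obtain ⟨N, G, hG⟩ := exists_gramMinor_pow_mul_eq hF
  obtain ⟨M, H, hH⟩ := exists_gramMinor_pow_mul_eq' hF
  set e := toArc (Fin 7) (gramMinor 0 1 5) with he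
  set e' := toArc (Fin 7) (gramMinor 2 0 4) with he'
  have h1 : arcMap gramMap e ^ (N + M) * F = arcMap gramMap (e ^ M * G) := by
    rw [map_mul, ← hG, map_pow]
    ring
  have h2 : arcMap gramMap e' ^ (N + M) * F = arcMap gramMap (e' ^ N * H) := by
    rw [map_mul, ← hH, map_pow]
    ring
  have h3 : e ^ M * G * e' ^ (N + M) - e ^ (N + M) * (e' ^ N * H) ∈ gramIdeal := by
    rw [mem_gramIdeal_iff, map_sub, map_mul _ (e ^ M * G), map_mul _ (e ^ (N + M)), ← h1, ← h2,
      map_pow, map_pow]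
    ring
  have h4 : e ^ M * G * e' ^ (N + M) ∈ Ideal.span {e ^ (N + M)} ⊔ gramIdeal := by
    have := add_mem (Ideal.mem_sup_right (S := Ideal.span {e ^ (N + M)}) h3)
      (Ideal.mem_sup_left (T := gramIdeal) (Ideal.mul_mem_right (e' ^ N * H) _
        (Ideal.mem_span_singleton_self (e ^ (N + M)))))
    rwa [sub_add_cancel] at this
  -- Cancelling the power of `e'` modulo the power of `e` and the relations makes the numerator a
  -- multiple `c * e ^ (N + M)`.
  obtain ⟨a, ha, b, hb, hab⟩ := Submodule.mem_sup.1 (mem_span_gramMinor_of_mul_mem h4)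
  obtain ⟨c, rfl⟩ := Ideal.mem_span_singleton'.1 ha
  refine ⟨c, ?_⟩
  refine mul_left_cancel₀ (pow_ne_zero (N + M) arcMap_gramMap_gramMinor_ne_zero) ?_
  rw [h1, ← hab, map_add, arcMap_gramMap_of_mem hb, map_mul, map_pow]
  ring

theorem currentInvariants_three :
    currentInvariants 3 = differentialSpan (classicalInvariants 3) := by
  refine le_antisymm (fun F hF => ?_) (differentialSpan_le_currentInvariants 3)
  obtain ⟨G, rfl⟩ := exists_arcMap_gramMap_eq hF
  exact arcMap_gramMap_mem G

/-! ### Two copies -/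

/-- The restriction of polynomial functions to the first two of three copies of `𝔰𝔩₂`. -/
def restrictCopies (p : Σ _ : Fin 3, Fin 3) : MvPolynomial (Σ _ : Fin 2, Fin 3) ℂ :=
  ![X ⟨0, p.2⟩, X ⟨1, p.2⟩, 0] p.1

lemma aeval_restrictCopies_mem {f : MvPolynomial (Σ _ : Fin 3, Fin 3) ℂ}
    (hf : f ∈ classicalInvariants 3) : aeval restrictCopies f ∈ classicalInvariants 2 := by
  rw [mem_classicalInvariants_iff] at hf ⊢
  intro g v
  have key : ∀ u : Fin 2 → Sl2, eval (fun p => sl2Coord (u p.1) p.2) (aeval restrictCopies f) =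
      eval (fun p => sl2Coord ((![u 0, u 1, 0] : Fin 3 → Sl2) p.1) p.2) f := by
    intro u
    rw [aeval_def, eval_eval₂]
    have h1 : (eval fun p : Σ _ : Fin 2, Fin 3 => sl2Coord (u p.1) p.2).comp
        (algebraMap ℂ (MvPolynomial (Σ _ : Fin 2, Fin 3) ℂ)) = RingHom.id ℂ := by
      ext
      simp
    rw [h1]
    have h2 : (fun s => eval (fun p : Σ _ : Fin 2, Fin 3 => sl2Coord (u p.1) p.2)
        (restrictCopies s)) =
        fun p => sl2Coord ((![u 0, u 1, 0] : Fin 3 → Sl2) p.1) p.2 := by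
      funext p
      obtain ⟨m, i⟩ := p
      fin_cases m <;> simp [restrictCopies]
    rw [h2]
    rfl
  have hv : (fun p : Σ _ : Fin 3, Fin 3 => sl2Coord
      ((![adjointRep g (v 0), adjointRep g (v 1), 0] : Fin 3 → Sl2) p.1) p.2) =
      fun p => sl2Coord (adjointRep g ((![v 0, v 1, 0] : Fin 3 → Sl2) p.1)) p.2 := by
    funext p
    obtain ⟨m, i⟩ := p
    fin_cases m <;> simp
  rw [key v, key fun m => adjointRep g (v m), hv]
  exact hf g ![v 0, v 1, 0]

lemma arcMap_restrictCopies_mem {F : ArcRing (Σ _ : Fin 3, Fin 3)}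
    (hF : F ∈ differentialSpan (classicalInvariants 3)) :
    arcMap restrictCopies F ∈ differentialSpan (classicalInvariants 2) := by
  have h : differentialSpan (classicalInvariants 3) ≤
      (differentialSpan (classicalInvariants 2)).comap (arcMap restrictCopies) := by
    refine Algebra.adjoin_le ?_
    rintro _ ⟨f, hf, k, rfl⟩
    change arcMap restrictCopies _ ∈ differentialSpan (classicalInvariants 2)
    rw [arcMap_iterate_arcD]
    exact Algebra.subset_adjoin ⟨_, aeval_restrictCopies_mem hf, k, rfl⟩
  exact h hF

theorem currentInvariants_two :
    currentInvariants 2 = differentialSpan (classicalInvariants 2) := by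
  refine le_antisymm (fun F hF => ?_) (differentialSpan_le_currentInvariants 2)
  -- Inclusion into three copies followed by restriction to a zero third vector is the identity, and
  -- restriction sends classical invariants to classical invariants.
  have h := copiesMap_mem (Fin.castSucc : Fin 2 → Fin 3) hF
  rw [currentInvariants_three] at h
  have h' := arcMap_restrictCopies_mem h
  rw [copiesMap, arcMap_arcMap] at h'
  have hX : (fun p : Σ _ : Fin 2, Fin 3 => aeval restrictCopies
      (X ⟨Fin.castSucc p.1, p.2⟩ : MvPolynomial (Σ _ : Fin 3, Fin 3) ℂ)) = fun p => X p := by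
    funext p
    obtain ⟨m, i⟩ := p
    fin_cases m <;> simp [restrictCopies]
  rw [hX, arcMap_id] at h'
  exact h'

end ArcSpace

end

theorem theorem6p1 :
    ArcSpace.currentInvariants 2 =
        ArcSpace.differentialSpan (ArcSpace.classicalInvariants 2) ∧
      ArcSpace.currentInvariants 3 =
        ArcSpace.differentialSpan (ArcSpace.classicalInvariants 3) :=
  ⟨ArcSpace.currentInvariants_two, ArcSpace.currentInvariants_three⟩
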